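/- Let $P$ be a Borel probability measure on $\mathbb{R}$ with bounded support, let $\lambda\ge 0$ and $\sigma\ge 0$. For $N\ge 1$ let $x^*\in\mathbb{R}^N$ have i.i.d. entries of law $P$, let $W$ be a real symmetric $N\times N$ matrix, independent of $x^*$, whose entries $W_{ij}$, $i\le j$, are independent with $W_{ij}\sim\mathcal{N}(0,1)$ for $i<j$ and $W_{ii}\sim\mathcal{N}(0,\sigma^2)$, and let $Y=\sqrt{\lambda/N}\,x^*x^{*\top}+W$ (the spiked Wigner model). Put $$-H(x)=\sum_{i<j}\Big(\sqrt{\tfrac{\lambda}{N}}\,Y_{ij}x_ix_j-\tfrac{\lambda}{2N}x_i^2x_j^2\Big),\qquad F_N=\frac1N\,\mathbb{E}\log\int e^{-H(x)}\,\mathrm{d}P^{\otimes N}(x),$$ and, for $r\ge 0$, with independent $x^*\sim P$ and $z\sim\mathcal{N}(0,1)$, $$\psi(r)=\mathbb{E}_{x^*,z}\log\int\exp\Big(\sqrt r\,zx+r\,xx^*-\tfrac r2x^2\Big)\,\mathrm{d}P(x),\qquad \phi_{\mathsf{RS}}(\lambda)=\sup_{q\ge 0}\Big[\psi(\lambda q)-\frac{\lambda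 q^2}{4}\Big].$$ Then all these integrals and expectations and the supremum are finite, and $$\lim_{N\to\infty}F_N=\phi_{\mathsf{RS}}(\lambda).$$ Moreover, there is a constant $K$ (which may depend on $\lambda$ and $P$, but not on $N$ or $\sigma$) such that $F_N\ge\phi_{\mathsf{RS}}(\lambda)-K/N$ for all $N\ge 1$ and $F_N\le\phi_{\mathsf{RS}}(\lambda)+K\,\log N/\sqrt N$ for all $N\ge 2$. -/

import Mathlib

open MeasureTheory ProbabilityTheory Filter Topology
open scoped NNReal

namespace SpikedWigner

noncomputable section

/-- The positions on or above the diagonal of an `N × N` matrix. -/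
abbrev UpperIndex (N : ℕ) : Type := {p : Fin N × Fin N // p.1 ≤ p.2}

/-- The law of the independent Gaussian entries `W i j`, `i ≤ j`: variance `1` off the diagonal and
variance `σ ^ 2` on the diagonal. -/
def noiseLaw (σ : ℝ≥0) (N : ℕ) : Measure (UpperIndex N → ℝ) :=
  Measure.pi fun p => gaussianReal 0 (if p.1.1 = p.1.2 then σ ^ 2 else 1)

/-- The symmetric matrix with the given entries on and above the diagonal. -/
def symmMatrix {N : ℕ} (w : UpperIndex N → ℝ) : Matrix (Fin N) (Fin N) ℝ :=
  Matrix.of fun i j => w ⟨(min i j, max i j), min_le_max⟩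

/-- The observed matrix `Y = √(lam / N) x* x*ᵀ + W`. -/
def observation (lam : ℝ) {N : ℕ} (xs : Fin N → ℝ) (w : UpperIndex N → ℝ) :
    Matrix (Fin N) (Fin N) ℝ :=
  √(lam / N) • Matrix.vecMulVec xs xs + symmMatrix w

/-- Minus the Hamiltonian: `∑_{i < j} (√(lam / N) Y_ij x_i x_j - lam / (2 N) x_i² x_j²)`. -/
def negHamiltonian (lam : ℝ) {N : ℕ} (Y : Matrix (Fin N) (Fin N) ℝ) (x : Fin N → ℝ) : ℝ :=
  ∑ i, ∑ j ∈ Finset.Ioi i,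
    (√(lam / N) * Y i j * x i * x j - lam / (2 * N) * x i ^ 2 * x j ^ 2)

/-- The partition function, that is, the normalizing constant of the posterior given `Y`. -/
def partitionFunction (P : Measure ℝ) (lam : ℝ) {N : ℕ} (Y : Matrix (Fin N) (Fin N) ℝ) : ℝ :=
  ∫ x, Real.exp (negHamiltonian lam Y x) ∂(Measure.pi fun _ : Fin N => P)

/-- The joint law of the spike (with i.i.d. entries of law `P`) and of the noise. -/
def jointLaw (P : Measure ℝ) (σ : ℝ≥0) (N : ℕ) :
    Measure ((Fin N → ℝ) × (UpperIndex N → ℝ)) :=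
  (Measure.pi fun _ : Fin N => P).prod (noiseLaw σ N)

/-- The random variable `log ∫ exp (-H(x)) dP^{⊗ N}(x)`, as a function of spike and noise. -/
def logPartition (P : Measure ℝ) (lam : ℝ) {N : ℕ} (ω : (Fin N → ℝ) × (UpperIndex N → ℝ)) : ℝ :=
  Real.log (partitionFunction P lam (observation lam ω.1 ω.2))

/-- The free entropy `F_N`. -/
def freeEntropy (P : Measure ℝ) (σ : ℝ≥0) (lam : ℝ) (N : ℕ) : ℝ :=
  1 / N * ∫ ω, logPartition P lam ω ∂(jointLaw P σ N)

/-- The integrand of the partition function of the scalar Gaussian channel. -/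
def scalarWeight (r xs z x : ℝ) : ℝ :=
  Real.exp (√r * z * x + r * x * xs - r / 2 * x ^ 2)

/-- The log-partition function of the scalar channel, as a function of `(x*, z)`. -/
def scalarLogPartition (P : Measure ℝ) (r : ℝ) (ω : ℝ × ℝ) : ℝ :=
  Real.log (∫ x, scalarWeight r ω.1 ω.2 x ∂P)

/-- `ψ(r)`, where `x* ∼ P` and `z ∼ N(0, 1)` are independent. -/
def psi (P : Measure ℝ) (r : ℝ) : ℝ :=
  ∫ ω, scalarLogPartition P r ω ∂(P.prod (gaussianReal 0 1))

/-- The replica-symmetric potential `F(lam, q)`. -/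
def rsPotential (P : Measure ℝ) (lam q : ℝ) : ℝ :=
  psi P (lam * q) - lam * q ^ 2 / 4

/-- The replica-symmetric formula. -/
def phiRS (P : Measure ℝ) (lam : ℝ) : ℝ :=
  sSup (rsPotential P lam '' Set.Ici 0)

end

end SpikedWigner

namespace SpikedWigner

noncomputable section

/-! ### Gibbs averages as integrals against tilted measures -/

section Tilted

variable {X : Type*} [MeasurableSpace X] {μ : Measure X} [IsProbabilityMeasure μ]

/-! The proof interpolates between the matrix channel and `N` independent scalar Gaussian channels.
The noises carry amplitudes sin s and cos s and the drifts carry weights sin² s and cos² s. Gaussian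
integration by parts (`FieldBound.hasDerivAt_integral_logPartition`) then gives the derivative of
the mean log-partition function as 2 sin s cos s times the mean of a functional of overlaps,
`overlapBracket`. The entries of `P` are clamped by a bounded `f` that is the identity `P`-almost
everywhere, so every estimate holds pointwise.

Lower bound (`le_interpFree`): the scalar strength is a constant q ≥ 0. The whole path is then a
Bayes-optimal inference problem, so the Nishimori identity exchanges the signal with a replica. Up
to diagonal terms of order one, the bracket has the mean of lam/(4N) · ((∑ x_i x*_i - Nq)² - N²q²).
Dropping the square leaves the loss lam N q²/4, which is exactly the subtracted term of the
potential.

Upper bound (`interpFree_le`): the strength may depend on the configuration. It is taken to be the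
overlap of `x` with the signal, rounded to the grid of mesh 1/N, and a penalty lam N m²/4 is
subtracted from the scalar energy. The signal terms of the bracket then complete to a square of size
O(1/N), and the terms with squared Gibbs averages are controlled by positivity of a two-replica
square (`two_mul_sum_sq_le`). Neither the Nishimori identity nor concentration of the overlap is
needed.

At the scalar end this leaves a sum over O(N) fixed strengths k (`interpFree_zero_le`). Each
contributes at most N times the potential at |k|; negative k are handled by
`integral_log_reflect_le`. The expected maximum over k exceeds the largest mean by O(√N log N),
through exponential moments at parameter 1/√N. -/

lemma integrable_of_abs_le {ν : Measure X} [IsFiniteMeasure ν] {f : X → ℝ} {C : ℝ}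
    (hf : Measurable f) (hC : ∀ x, |f x| ≤ C) : Integrable f ν :=
  .of_bound hf.aestronglyMeasurable C (.of_forall hC)

lemma integrable_mul_exp {ν : Measure X} [IsFiniteMeasure ν] {f H : X → ℝ} {K C : ℝ}
    (hf : Measurable f) (hfK : ∀ x, |f x| ≤ K) (hH : Measurable H) (hC : ∀ x, |H x| ≤ C) :
    Integrable (fun x => f x * Real.exp (H x)) ν := by
  refine integrable_of_abs_le (C := K * Real.exp C) (by fun_prop) fun x => ?_
  rw [abs_mul, Real.abs_exp]
  have := (abs_nonneg (f x)).trans (hfK x)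
  exact mul_le_mul (hfK x) (Real.exp_le_exp.2 ((le_abs_self _).trans (hC x))) (by positivity) this

lemma integrable_exp_of_abs_le {ν : Measure X} [IsFiniteMeasure ν] {H : X → ℝ} {C : ℝ}
    (hH : Measurable H) (hC : ∀ x, |H x| ≤ C) : Integrable (fun x => Real.exp (H x)) ν := by
  simpa using integrable_mul_exp (f := fun _ => 1) (K := 1) (ν := ν) (by fun_prop) (by simp) hH hC

lemma integral_tilted_eq_div (μ : Measure X) (H f : X → ℝ) :
    ∫ x, f x ∂(μ.tilted H) = (∫ x, f x * Real.exp (H x) ∂μ) / ∫ x, Real.exp (H x) ∂μ := by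
  rw [integral_tilted, ← integral_div]
  refine integral_congr_ae (.of_forall fun x => ?_)
  simp only [smul_eq_mul]
  ring

lemma integral_exp_pos_of_abs_le {H : X → ℝ} {C : ℝ}
    (hH : Measurable H) (hC : ∀ x, |H x| ≤ C) : 0 < ∫ x, Real.exp (H x) ∂μ :=
  integral_exp_pos (integrable_exp_of_abs_le hH hC)

lemma abs_log_integral_exp_le {H : X → ℝ} {C : ℝ}
    (hH : Measurable H) (hC : ∀ x, |H x| ≤ C) : |Real.log (∫ x, Real.exp (H x) ∂μ)| ≤ C := by
  have hi := integrable_exp_of_abs_le (ν := μ) hH hC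
  have hpos := integral_exp_pos_of_abs_le (μ := μ) hH hC
  have h1 : ∫ x, Real.exp (H x) ∂μ ≤ Real.exp C := by
    have := integral_mono hi (integrable_const (Real.exp C)) fun x =>
      Real.exp_le_exp.2 ((le_abs_self _).trans (hC x))
    simpa using this
  have h2 : Real.exp (-C) ≤ ∫ x, Real.exp (H x) ∂μ := by
    have := integral_mono (integrable_const (Real.exp (-C))) hi fun x =>
      Real.exp_le_exp.2 (neg_le_of_abs_le (hC x))
    simpa using this
  rw [abs_le]
  exact ⟨(Real.le_log_iff_exp_le hpos).2 h2, (Real.log_le_iff_le_exp hpos).2 h1⟩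

lemma abs_integral_tilted_le {H f : X → ℝ} {C K : ℝ} (hH : Measurable H) (hC : ∀ x, |H x| ≤ C)
    (hK : ∀ x, |f x| ≤ K) : |∫ x, f x ∂(μ.tilted H)| ≤ K := by
  have := isProbabilityMeasure_tilted (integrable_exp_of_abs_le (ν := μ) hH hC)
  simpa using norm_integral_le_of_norm_le_const (μ := μ.tilted H) (f := f) (C := K)
    (.of_forall hK)

lemma measurable_integral_param {α : Type*} [MeasurableSpace α] {f : α → X → ℝ}
    (hf : Measurable (Function.uncurry f)) : Measurable fun a => ∫ x, f a x ∂μ :=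
  (hf.stronglyMeasurable.integral_prod_right).measurable

lemma measurable_integral_tilted {α : Type*} [MeasurableSpace α] {H f : α → X → ℝ}
    (hH : Measurable (Function.uncurry H)) (hf : Measurable (Function.uncurry f)) :
    Measurable fun a => ∫ x, f a x ∂(μ.tilted (H a)) := by
  simp only [integral_tilted_eq_div]
  refine Measurable.div (measurable_integral_param ?_) (measurable_integral_param ?_)
  · exact hf.mul (Real.measurable_exp.comp hH)
  · exact Real.measurable_exp.comp hH

lemma hasDerivAt_integral_mul_exp {f : X → ℝ} {H H' : ℝ → X → ℝ} {K C C' s₀ : ℝ}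
    (hf : Measurable f) (hfK : ∀ x, |f x| ≤ K)
    (hH : ∀ s, Measurable (H s)) (hH' : ∀ s, Measurable (H' s))
    (hC : ∀ s ∈ Metric.ball s₀ 1, ∀ x, |H s x| ≤ C)
    (hC' : ∀ s ∈ Metric.ball s₀ 1, ∀ x, |H' s x| ≤ C')
    (hd : ∀ s x, HasDerivAt (fun s => H s x) (H' s x) s) :
    HasDerivAt (fun s => ∫ x, f x * Real.exp (H s x) ∂μ)
      (∫ x, f x * H' s₀ x * Real.exp (H s₀ x) ∂μ) s₀ := by
  have h0 : s₀ ∈ Metric.ball s₀ 1 := Metric.mem_ball_self one_pos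
  refine (hasDerivAt_integral_of_dominated_loc_of_deriv_le (bound := fun _ => K * C' * Real.exp C)
    (F' := fun s x => f x * H' s x * Real.exp (H s x))
    (Metric.ball_mem_nhds s₀ one_pos) ?_ ?_ ?_ ?_ (integrable_const _) ?_).2
  · exact .of_forall fun s => by have := hH s; fun_prop
  · exact integrable_mul_exp hf hfK (hH s₀) (hC s₀ h0)
  · have := hH s₀; have := hH' s₀; fun_prop
  · refine .of_forall fun x s hs => ?_
    have hK0 := (abs_nonneg _).trans (hfK x)
    have hC0 := (abs_nonneg _).trans (hC' s hs x)
    rw [Real.norm_eq_abs, abs_mul, abs_mul, Real.abs_exp]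
    gcongr
    · exact hfK x
    · exact hC' s hs x
    · exact (le_abs_self _).trans (hC s hs x)
  · refine .of_forall fun x s _ => ?_
    exact (((hd s x).exp).const_mul (f x)).congr_deriv (by ring)

lemma hasDerivAt_log_integral_exp {H H' : ℝ → X → ℝ} {C C' s₀ : ℝ}
    (hH : ∀ s, Measurable (H s)) (hH' : ∀ s, Measurable (H' s))
    (hC : ∀ s ∈ Metric.ball s₀ 1, ∀ x, |H s x| ≤ C)
    (hC' : ∀ s ∈ Metric.ball s₀ 1, ∀ x, |H' s x| ≤ C')
    (hd : ∀ s x, HasDerivAt (fun s => H s x) (H' s x) s) :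
    HasDerivAt (fun s => Real.log (∫ x, Real.exp (H s x) ∂μ))
      (∫ x, H' s₀ x ∂(μ.tilted (H s₀))) s₀ := by
  have h0 : s₀ ∈ Metric.ball s₀ 1 := Metric.mem_ball_self one_pos
  have hpos := integral_exp_pos_of_abs_le (μ := μ) (hH s₀) (hC s₀ h0)
  have := hasDerivAt_integral_mul_exp (μ := μ) (f := fun _ => 1) (K := 1) (by fun_prop) (by simp)
    hH hH' hC hC' hd
  simp only [one_mul] at this
  rw [integral_tilted_eq_div]
  exact this.log hpos.ne'

/-- Quotient rule: the response of a Gibbs average to a change of energy is the Gibbs covariance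
with the derivative of the energy. -/
lemma hasDerivAt_integral_tilted {f : X → ℝ} {H H' : ℝ → X → ℝ} {K C C' s₀ : ℝ}
    (hf : Measurable f) (hfK : ∀ x, |f x| ≤ K)
    (hH : ∀ s, Measurable (H s)) (hH' : ∀ s, Measurable (H' s))
    (hC : ∀ s ∈ Metric.ball s₀ 1, ∀ x, |H s x| ≤ C)
    (hC' : ∀ s ∈ Metric.ball s₀ 1, ∀ x, |H' s x| ≤ C')
    (hd : ∀ s x, HasDerivAt (fun s => H s x) (H' s x) s) :
    HasDerivAt (fun s => ∫ x, f x ∂(μ.tilted (H s)))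
      (∫ x, f x * H' s₀ x ∂(μ.tilted (H s₀)) -
        (∫ x, f x ∂(μ.tilted (H s₀))) * ∫ x, H' s₀ x ∂(μ.tilted (H s₀))) s₀ := by
  have h0 : s₀ ∈ Metric.ball s₀ 1 := Metric.mem_ball_self one_pos
  have hpos := integral_exp_pos_of_abs_le (μ := μ) (hH s₀) (hC s₀ h0)
  have h1 := hasDerivAt_integral_mul_exp (μ := μ) (f := fun _ => 1) (K := 1) (by fun_prop) (by simp)
    hH hH' hC hC' hd
  have h2 := hasDerivAt_integral_mul_exp (μ := μ) hf hfK hH hH' hC hC' hd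
  simp only [one_mul] at h1
  simp only [integral_tilted_eq_div]
  exact (h2.div h1 hpos.ne').congr_deriv (by field_simp)

end Tilted

/-! ### Gaussian vectors: integration by parts and translation -/

section Gaussian

/-- The law of a vector of independent standard Gaussian variables. -/
abbrev gaussPi (ι : Type*) [Fintype ι] : Measure (ι → ℝ) :=
  Measure.pi fun _ => gaussianReal 0 1

lemma integrable_abs_gaussian : Integrable (fun z : ℝ => |z|) (gaussianReal 0 1) :=
  ((memLp_id_gaussianReal (μ := 0) (v := 1) 1).integrable (by simp)).abs

lemma integrable_exp_abs_gaussian (t : ℝ) :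
    Integrable (fun z : ℝ => Real.exp (t * |z|)) (gaussianReal 0 1) :=
  integrable_exp_mul_abs (X := fun z : ℝ => z) (integrable_exp_mul_gaussianReal t)
    (integrable_exp_mul_gaussianReal (-t))

lemma hasDerivAt_gaussianPDFReal (x : ℝ) :
    HasDerivAt (gaussianPDFReal 0 1) (-x * gaussianPDFReal 0 1 x) x := by
  have h : HasDerivAt (fun x : ℝ => -(x - 0) ^ 2 / (2 * ((1 : ℝ≥0) : ℝ))) (-x) x := by
    exact ((((hasDerivAt_id x).sub_const 0).pow 2).neg.div_const
      (2 * ((1 : ℝ≥0) : ℝ))).congr_deriv (by simp; ring)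
  exact (h.exp.const_mul (√(2 * Real.pi * ((1 : ℝ≥0) : ℝ)))⁻¹).congr_deriv
    (by simp only [gaussianPDFReal]; ring)

/-- Stein's identity: the Gaussian density p satisfies p'(x) = -x p(x), so this is integration by
parts on the line. Boundedness of `F` and `F'` supplies the integrability. -/
lemma integral_mul_gaussian {F F' : ℝ → ℝ} {K : ℝ} (hFm : Measurable F) (hFm' : Measurable F')
    (hF : ∀ x, HasDerivAt F (F' x) x) (hK : ∀ x, |F x| ≤ K) (hK' : ∀ x, |F' x| ≤ K) :
    ∫ z, z * F z ∂(gaussianReal 0 1) = ∫ z, F' z ∂(gaussianReal 0 1) := by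
  have key : ∀ {h : ℝ → ℝ}, Integrable h (gaussianReal 0 1) →
      Integrable (fun x => gaussianPDFReal 0 1 x * h x) := fun {h} hh => by
    rw [gaussianReal_of_var_ne_zero _ one_ne_zero] at hh
    rw [integrable_withDensity_iff (measurable_gaussianPDF 0 1)
      (.of_forall fun _ => gaussianPDF_lt_top)] at hh
    simpa [mul_comm, toReal_gaussianPDF] using hh
  have hint : Integrable (fun z => z * F z) (gaussianReal 0 1) := by
    refine (integrable_abs_gaussian.mul_const K).mono' (by fun_prop) (.of_forall fun z => ?_)
    rw [Real.norm_eq_abs, abs_mul]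
    exact mul_le_mul_of_nonneg_left (hK z) (abs_nonneg _)
  rw [integral_gaussianReal_eq_integral_smul one_ne_zero,
    integral_gaussianReal_eq_integral_smul one_ne_zero]
  have := integral_mul_deriv_eq_deriv_mul_of_integrable (u := F) (v := gaussianPDFReal 0 1)
    (u' := F') (v' := fun x => -x * gaussianPDFReal 0 1 x) (fun x _ => hF x)
    (fun x _ => hasDerivAt_gaussianPDFReal x) ?_ ?_ ?_
  · simp only [smul_eq_mul]
    rw [show (∫ x, gaussianPDFReal 0 1 x * F' x) = ∫ x, F' x * gaussianPDFReal 0 1 x by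
      simp only [mul_comm], ← neg_eq_iff_eq_neg.2 this, ← integral_neg]
    congr 1
    ext x
    ring
  · exact (key hint).neg.congr (.of_forall fun x => by simp; ring)
  · exact (key (integrable_of_abs_le (ν := gaussianReal 0 1) hFm' hK')).congr
      (.of_forall fun x => by simp [mul_comm])
  · exact (key (integrable_of_abs_le (ν := gaussianReal 0 1) hFm hK)).congr
      (.of_forall fun x => by simp [mul_comm])

variable {ι : Type*} [Fintype ι]

/-- Resampling one coordinate preserves a product law. By Fubini, this reduces coordinatewise
identities for Gaussian vectors to dimension one. -/
lemma measurePreserving_update_pi [DecidableEq ι] (ν : ι → Measure ℝ)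
    [∀ i, IsProbabilityMeasure (ν i)] (a : ι) :
    MeasurePreserving (fun p : (ι → ℝ) × ℝ => Function.update p.1 a p.2)
      ((Measure.pi ν).prod (ν a)) (Measure.pi ν) := by
  have hm : Measurable fun p : (ι → ℝ) × ℝ => Function.update p.1 a p.2 := by
    refine measurable_pi_iff.2 fun i => ?_
    by_cases h : i = a
    · subst h; simpa using measurable_snd
    · simp only [Function.update_of_ne h]; fun_prop
  refine ⟨hm, (Measure.pi_eq fun s hs => ?_).symm⟩
  rw [Measure.map_apply hm (.univ_pi hs)]
  have : (fun p : (ι → ℝ) × ℝ => Function.update p.1 a p.2) ⁻¹' Set.univ.pi s =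
      (Set.univ.pi (Function.update s a Set.univ)) ×ˢ s a := by
    ext ⟨g, t⟩
    simp only [Set.mem_preimage, Set.mem_pi, Set.mem_univ, true_imp_iff, Set.mem_prod]
    constructor
    · intro h
      refine ⟨fun i => ?_, by simpa using h a⟩
      by_cases hi : i = a
      · subst hi; simp
      · simpa [hi] using h i
    · rintro ⟨h, ht⟩ i
      by_cases hi : i = a
      · subst hi; simpa using ht
      · simpa [hi] using h i
  rw [this, Measure.prod_prod, Measure.pi_pi, ← Finset.prod_erase_mul _ _ (Finset.mem_univ a),
    ← Finset.prod_erase_mul Finset.univ (fun i => ν i (s i)) (Finset.mem_univ a)]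
  simp only [Function.update_self, measure_univ, mul_one]
  congr 1
  exact Finset.prod_congr rfl fun i hi => by
    rw [Function.update_of_ne (Finset.ne_of_mem_erase hi)]

lemma integrable_coord_gaussPi (a : ι) : Integrable (fun g : ι → ℝ => |g a|) (gaussPi ι) :=
  integrable_comp_eval (μ := fun _ : ι => gaussianReal 0 1) integrable_abs_gaussian

lemma integral_coord_mul_gaussPi [DecidableEq ι] (a : ι) {F F' : (ι → ℝ) → ℝ} {K : ℝ}
    (hFm : Measurable F) (hFm' : Measurable F') (hK : ∀ x, |F x| ≤ K) (hK' : ∀ x, |F' x| ≤ K)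
    (hF : ∀ g, HasDerivAt (fun s => F (Function.update g a s)) (F' g) (g a)) :
    ∫ g, g a * F g ∂(gaussPi ι) = ∫ g, F' g ∂(gaussPi ι) := by
  have hmp := measurePreserving_update_pi (fun _ : ι => gaussianReal 0 1) a
  have hint : Integrable (fun g => g a * F g) (gaussPi ι) := by
    refine ((integrable_coord_gaussPi a).mul_const K).mono' (by fun_prop)
      (.of_forall fun z => ?_)
    rw [Real.norm_eq_abs, abs_mul]
    exact mul_le_mul_of_nonneg_left (hK z) (abs_nonneg _)
  have hint' : Integrable F' (gaussPi ι) := integrable_of_abs_le hFm' hK'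
  have e1 : ∫ g, g a * F g ∂(gaussPi ι) =
      ∫ p, p.2 * F (Function.update p.1 a p.2) ∂((gaussPi ι).prod (gaussianReal 0 1)) := by
    conv_lhs => rw [gaussPi, ← hmp.map_eq]
    rw [integral_map hmp.measurable.aemeasurable (by fun_prop)]
    simp
  have e2 : ∫ g, F' g ∂(gaussPi ι) =
      ∫ p, F' (Function.update p.1 a p.2) ∂((gaussPi ι).prod (gaussianReal 0 1)) := by
    conv_lhs => rw [gaussPi, ← hmp.map_eq]
    rw [integral_map hmp.measurable.aemeasurable (by fun_prop)]
  rw [e1, e2, integral_prod, integral_prod]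
  · refine integral_congr_ae (.of_forall fun g => ?_)
    refine integral_mul_gaussian (K := K) (hFm.comp (measurable_update g))
      (hFm'.comp (measurable_update g)) (fun s => ?_) (fun s => hK _) fun s => hK' _
    simpa using hF (Function.update g a s)
  · exact hmp.integrable_comp_of_integrable hint'
  · simpa [Function.comp_def] using hmp.integrable_comp_of_integrable hint

/-- Expanding the square in the density of the shifted Gaussian. The tensorized form below
identifies observation densities with likelihoods. -/
lemma gaussianReal_map_add_eq_withDensity (u : ℝ) :
    (gaussianReal 0 1).map (fun z => z + u) =
      (gaussianReal 0 1).withDensity fun z => ENNReal.ofReal (Real.exp (u * z - u ^ 2 / 2)) := by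
  rw [gaussianReal_map_add_const, zero_add, gaussianReal_of_var_ne_zero _ one_ne_zero,
    gaussianReal_of_var_ne_zero _ one_ne_zero, ← withDensity_mul _ (measurable_gaussianPDF 0 1)
      (by fun_prop)]
  congr 1
  ext x
  rw [Pi.mul_apply, gaussianPDF, gaussianPDF, ← ENNReal.ofReal_mul (gaussianPDFReal_nonneg _ _ _),
    gaussianPDFReal, gaussianPDFReal, mul_assoc (√(2 * Real.pi * ((1 : ℝ≥0) : ℝ)))⁻¹,
    ← Real.exp_add]
  congr 3
  simp
  ring

lemma lintegral_fintype_prod_eq_prod (ν : ι → Measure ℝ) [∀ i, IsProbabilityMeasure (ν i)]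
    {f : ι → ℝ → ENNReal} (hf : ∀ i, Measurable (f i)) :
    ∫⁻ x, ∏ i, f i (x i) ∂(Measure.pi ν) = ∏ i, ∫⁻ t, f i t ∂(ν i) := by
  have hind : iIndepFun (fun i (x : ι → ℝ) => f i (x i)) (Measure.pi ν) :=
    iIndepFun_pi (μ := ν) (X := fun i => f i) fun i => (hf i).aemeasurable
  rw [lintegral_prod_eq_prod_lintegral_of_indepFun Finset.univ (fun i (x : ι → ℝ) => f i (x i))
    hind fun i => (hf i).comp (measurable_pi_apply i)]
  refine Finset.prod_congr rfl fun i _ => ?_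
  exact (measurePreserving_eval ν i).lintegral_comp (hf i)

lemma gaussPi_map_add_eq_withDensity (u : ι → ℝ) :
    (gaussPi ι).map (fun g => g + u) =
      (gaussPi ι).withDensity fun g =>
        ENNReal.ofReal (Real.exp (∑ a, (u a * g a - u a ^ 2 / 2))) := by
  have h1 := Measure.pi_map_pi (μ := fun _ : ι => gaussianReal 0 1)
    (f := fun a z => z + u a) (fun a => by fun_prop)
  have h2 : (gaussPi ι).map (fun g => g + u) =
      Measure.pi fun a => (gaussianReal 0 1).map (fun z => z + u a) := h1
  rw [h2]
  have : ∀ a, IsProbabilityMeasure ((gaussianReal 0 1).map (fun z => z + u a)) := fun a =>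
    Measure.isProbabilityMeasure_map (by fun_prop)
  refine Measure.pi_eq fun s hs => ?_
  rw [withDensity_apply _ (.univ_pi hs), ← lintegral_indicator (.univ_pi hs)]
  have : (Set.univ.pi s).indicator (fun g : ι → ℝ =>
      ENNReal.ofReal (Real.exp (∑ a, (u a * g a - u a ^ 2 / 2)))) = fun g =>
      ∏ a, (s a).indicator (fun z => ENNReal.ofReal (Real.exp (u a * z - u a ^ 2 / 2))) (g a) := by
    ext g
    by_cases hg : g ∈ Set.univ.pi s
    · rw [Set.indicator_of_mem hg, Real.exp_sum,
        ENNReal.ofReal_prod_of_nonneg fun _ _ => (Real.exp_pos _).le]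
      exact Finset.prod_congr rfl fun a _ => by rw [Set.indicator_of_mem (hg a trivial)]
    · rw [Set.indicator_of_notMem hg]
      simp only [Set.mem_pi, Set.mem_univ, true_imp_iff, not_forall] at hg
      obtain ⟨a, ha⟩ := hg
      exact (Finset.prod_eq_zero (Finset.mem_univ a) (by rw [Set.indicator_of_notMem ha])).symm
  rw [this, lintegral_fintype_prod_eq_prod _ fun a => Measurable.indicator (by fun_prop) (hs a)]
  refine Finset.prod_congr rfl fun a _ => ?_
  rw [gaussianReal_map_add_eq_withDensity, withDensity_apply _ (hs a), lintegral_indicator (hs a)]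

end Gaussian

/-! ### Gaussian interpolation -/

section Interpolation

variable {Ω X ι : Type*} [MeasurableSpace Ω] [MeasurableSpace X] [Fintype ι]

/-- A Gaussian field with covariates `v`, coordinatewise amplitudes `r`, and drift `c + b d`. -/
def fieldEnergy (v : Ω → X → ι → ℝ) (c d : Ω → X → ℝ) (r : ι → ℝ) (b : ℝ)
    (ω : Ω) (g : ι → ℝ) (x : X) : ℝ :=
  ∑ a, r a * v ω x a * g a + c ω x + b * d ω x

/-- Boundedness and measurability of the data of a Gaussian field. -/
structure FieldBound (v : Ω → X → ι → ℝ) (c d : Ω → X → ℝ) (C : ℝ) : Prop where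
  measurable_v : ∀ a, Measurable fun p : Ω × X => v p.1 p.2 a
  measurable_c : Measurable fun p : Ω × X => c p.1 p.2
  measurable_d : Measurable fun p : Ω × X => d p.1 p.2
  abs_v_le : ∀ ω x a, |v ω x a| ≤ C
  abs_c_le : ∀ ω x, |c ω x| ≤ C
  abs_d_le : ∀ ω x, |d ω x| ≤ C

variable {v : Ω → X → ι → ℝ} {c d : Ω → X → ℝ} {C : ℝ} (h : FieldBound v c d C)
include h

lemma FieldBound.measurable_energy (r : ι → ℝ) (b : ℝ) :
    Measurable fun p : (Ω × (ι → ℝ)) × X => fieldEnergy v c d r b p.1.1 p.1.2 p.2 := by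
  have hv := fun a => (h.measurable_v a).comp
    (show Measurable fun p : (Ω × (ι → ℝ)) × X => (p.1.1, p.2) by fun_prop)
  have hc := h.measurable_c.comp
    (show Measurable fun p : (Ω × (ι → ℝ)) × X => (p.1.1, p.2) by fun_prop)
  have hd := h.measurable_d.comp
    (show Measurable fun p : (Ω × (ι → ℝ)) × X => (p.1.1, p.2) by fun_prop)
  simp only [Function.comp_def] at hv hc hd
  unfold fieldEnergy
  exact ((Finset.measurable_sum _ fun a _ => ((hv a).const_mul (r a)).mul (by fun_prop)).add
    hc).add (hd.const_mul b)

lemma FieldBound.abs_energy_le {r : ι → ℝ} {b : ℝ} (hr : ∀ a, |r a| ≤ 1) (hb : |b| ≤ 1)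
    (ω : Ω) (g : ι → ℝ) (x : X) :
    |fieldEnergy v c d r b ω g x| ≤ C * (∑ a, |g a| + 2) := by
  have hC : 0 ≤ C := (abs_nonneg _).trans (h.abs_c_le ω x)
  have h1 : |∑ a, r a * v ω x a * g a| ≤ C * ∑ a, |g a| := by
    rw [Finset.mul_sum]
    refine (Finset.abs_sum_le_sum_abs _ _).trans (Finset.sum_le_sum fun a _ => ?_)
    rw [abs_mul, abs_mul]
    refine mul_le_mul_of_nonneg_right ?_ (abs_nonneg _)
    calc |r a| * |v ω x a| ≤ 1 * C :=
          mul_le_mul (hr a) (h.abs_v_le ω x a) (abs_nonneg _) zero_le_one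
      _ = C := one_mul C
  have h2 : |b * d ω x| ≤ C := by
    rw [abs_mul]
    calc |b| * |d ω x| ≤ 1 * C := mul_le_mul hb (h.abs_d_le ω x) (abs_nonneg _) zero_le_one
      _ = C := one_mul C
  have h3 := h.abs_c_le ω x
  unfold fieldEnergy
  refine (abs_add_le _ _).trans ?_
  have := abs_add_le (∑ a, r a * v ω x a * g a) (c ω x)
  linarith

-- The energy is affine in each noise coordinate, so its partial derivative in `g a` is the constant
-- `r a * v ω x a`.
omit h [MeasurableSpace Ω] [MeasurableSpace X] in
lemma fieldEnergy_update [DecidableEq ι] (v : Ω → X → ι → ℝ) (c d : Ω → X → ℝ)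
    (r : ι → ℝ) (b : ℝ) (ω : Ω) (g : ι → ℝ) (x : X) (a : ι) (s : ℝ) :
    fieldEnergy v c d r b ω (Function.update g a s) x =
      fieldEnergy v c d r b ω g x + r a * v ω x a * (s - g a) := by
  unfold fieldEnergy
  rw [← Finset.add_sum_erase _ _ (Finset.mem_univ a),
    ← Finset.add_sum_erase Finset.univ (fun a => r a * v ω x a * g a) (Finset.mem_univ a)]
  have : ∑ i ∈ Finset.univ.erase a, r i * v ω x i * Function.update g a s i =
      ∑ i ∈ Finset.univ.erase a, r i * v ω x i * g i :=
    Finset.sum_congr rfl fun i hi => by rw [Function.update_of_ne (Finset.ne_of_mem_erase hi)]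
  rw [this, Function.update_self]
  ring

variable (μ : Measure X) [IsProbabilityMeasure μ] (ν : Measure Ω) [IsProbabilityMeasure ν]

lemma FieldBound.measurable_gibbs {f : Ω → X → ℝ} (hf : Measurable fun p : Ω × X => f p.1 p.2)
    (r : ι → ℝ) (b : ℝ) :
    Measurable fun p : Ω × (ι → ℝ) =>
      ∫ x, f p.1 x ∂(μ.tilted (fieldEnergy v c d r b p.1 p.2)) :=
  measurable_integral_tilted (h.measurable_energy r b)
    (hf.comp (show Measurable fun p : (Ω × (ι → ℝ)) × X => (p.1.1, p.2) by fun_prop))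

lemma FieldBound.measurable_logPartition (r : ι → ℝ) (b : ℝ) :
    Measurable fun p : Ω × (ι → ℝ) =>
      Real.log (∫ x, Real.exp (fieldEnergy v c d r b p.1 p.2 x) ∂μ) :=
  Real.measurable_log.comp
    (measurable_integral_param (Real.measurable_exp.comp (h.measurable_energy r b)))

lemma FieldBound.measurable_energy_right (r : ι → ℝ) (b : ℝ) (ω : Ω) (g : ι → ℝ) :
    Measurable (fieldEnergy v c d r b ω g) :=
  (h.measurable_energy r b).comp (measurable_prodMk_left (x := (ω, g)))

lemma FieldBound.abs_gibbs_le {f : X → ℝ} {K : ℝ} (hf : ∀ x, |f x| ≤ K) {r : ι → ℝ} {b : ℝ}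
    (hr : ∀ a, |r a| ≤ 1) (hb : |b| ≤ 1) (ω : Ω) (g : ι → ℝ) :
    |∫ x, f x ∂(μ.tilted (fieldEnergy v c d r b ω g))| ≤ K :=
  abs_integral_tilted_le (h.measurable_energy_right r b ω g) (h.abs_energy_le hr hb ω g) hf

omit h in
lemma integrable_sum_abs_gaussPi (A B : ℝ) :
    Integrable (fun p : Ω × (ι → ℝ) => A * (∑ a, |p.2 a| + B)) (ν.prod (gaussPi ι)) := by
  refine ((integrable_finsetSum _ fun a _ => ?_).add (integrable_const B)).const_mul A
  exact (integrable_coord_gaussPi a).comp_snd ν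

lemma FieldBound.integrable_logPartition {r : ι → ℝ} {b : ℝ} (hr : ∀ a, |r a| ≤ 1)
    (hb : |b| ≤ 1) :
    Integrable (fun p : Ω × (ι → ℝ) =>
      Real.log (∫ x, Real.exp (fieldEnergy v c d r b p.1 p.2 x) ∂μ)) (ν.prod (gaussPi ι)) :=
  (integrable_sum_abs_gaussPi ν C 2).mono'
    (h.measurable_logPartition μ r b).aestronglyMeasurable (.of_forall fun p =>
      abs_log_integral_exp_le (h.measurable_energy_right r b p.1 p.2)
        (h.abs_energy_le hr hb p.1 p.2))

/-- Stein's identity applied to the Gibbs average of `v ω x a`, whose derivative in `g a` is `r a`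
times the Gibbs variance. The sample `ω` is frozen. -/
lemma FieldBound.integral_coord_mul_gibbs {r : ι → ℝ} {b : ℝ} (hr : ∀ a, |r a| ≤ 1)
    (hb : |b| ≤ 1) (ω : Ω) (a : ι) :
    ∫ g, g a * ∫ x, v ω x a ∂(μ.tilted (fieldEnergy v c d r b ω g)) ∂(gaussPi ι) =
      ∫ g, r a * (∫ x, v ω x a ^ 2 ∂(μ.tilted (fieldEnergy v c d r b ω g)) -
        (∫ x, v ω x a ∂(μ.tilted (fieldEnergy v c d r b ω g))) ^ 2) ∂(gaussPi ι) := by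
  classical
  have hmω : Measurable fun g : ι → ℝ => (ω, g) := measurable_prodMk_left
  have hv1 := (h.measurable_gibbs μ (f := fun ω x => v ω x a) (h.measurable_v a) r b).comp hmω
  have hv2 := (h.measurable_gibbs μ (f := fun ω x => v ω x a ^ 2)
    ((h.measurable_v a).pow_const 2) r b).comp hmω
  simp only [Function.comp_def] at hv1 hv2
  have hvm : Measurable fun x => v ω x a := (h.measurable_v a).comp measurable_prodMk_left
  have hb1 := fun g => h.abs_gibbs_le μ (fun x => h.abs_v_le ω x a) hr hb ω g
  have hb2 : ∀ g, |∫ x, v ω x a ^ 2 ∂(μ.tilted (fieldEnergy v c d r b ω g))| ≤ C ^ 2 := fun g =>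
    h.abs_gibbs_le μ (fun x => by
      rw [abs_pow]; exact pow_le_pow_left₀ (abs_nonneg _) (h.abs_v_le ω x a) 2) hr hb ω g
  refine integral_coord_mul_gaussPi a (K := max C (C ^ 2 + C ^ 2)) hv1 (by fun_prop)
    (fun g => (hb1 g).trans (le_max_left _ _)) (fun g => ?_) fun g => ?_
  · refine le_trans ?_ (le_max_right _ _)
    rw [abs_mul]
    calc _ ≤ 1 * (C ^ 2 + C ^ 2) := by
          refine mul_le_mul (hr a) ?_ (abs_nonneg _) zero_le_one
          refine (abs_sub _ _).trans (add_le_add (hb2 g) ?_)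
          rw [abs_pow]
          exact pow_le_pow_left₀ (abs_nonneg _) (hb1 g) 2
      _ = _ := one_mul _
  · have key := hasDerivAt_integral_tilted (μ := μ) (f := fun x => v ω x a) (K := C) (s₀ := g a)
      (H := fun s => fieldEnergy v c d r b ω (Function.update g a s))
      (H' := fun _ x => r a * v ω x a) (C := C * (∑ i, |g i| + 2) + 1 * C * 1) (C' := 1 * C)
      hvm (fun x => h.abs_v_le ω x a) (fun s => h.measurable_energy_right r b ω _)
      (fun s => by fun_prop) (fun s hs x => ?_) (fun s hs x => ?_) fun s x => ?_
    · refine key.congr_deriv ?_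
      simp only [Function.update_eq_self]
      simp only [mul_left_comm _ (r a), integral_const_mul]
      simp only [← pow_two]
      ring
    · rw [fieldEnergy_update]
      refine (abs_add_le _ _).trans (add_le_add (h.abs_energy_le hr hb ω g x) ?_)
      rw [abs_mul, abs_mul]
      have hC : 0 ≤ C := (abs_nonneg _).trans (h.abs_c_le ω x)
      rw [Metric.mem_ball, Real.dist_eq] at hs
      gcongr
      · exact hr a
      · exact h.abs_v_le ω x a
    · rw [abs_mul]
      exact mul_le_mul (hr a) (h.abs_v_le ω x a) (abs_nonneg _) zero_le_one
    · simp only [fieldEnergy_update]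
      exact ((((hasDerivAt_id s).sub_const (g a)).const_mul (r a * v ω x a)).const_add
        _).congr_deriv (by simp)

/-- Differentiation of the mean log-partition function along a path of amplitudes. -/
theorem FieldBound.hasDerivAt_integral_logPartition {ρ ρ' : ι → ℝ → ℝ} {β β' : ℝ → ℝ}
    (hρ : ∀ a s, HasDerivAt (ρ a) (ρ' a s) s) (hβ : ∀ s, HasDerivAt β (β' s) s)
    (hρ1 : ∀ a s, |ρ a s| ≤ 1) (hρ1' : ∀ a s, |ρ' a s| ≤ 1)
    (hβ1 : ∀ s, |β s| ≤ 1) (hβ1' : ∀ s, |β' s| ≤ 1) (s₀ : ℝ) :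
    HasDerivAt (fun s => ∫ p : Ω × (ι → ℝ), Real.log (∫ x, Real.exp
        (fieldEnergy v c d (fun a => ρ a s) (β s) p.1 p.2 x) ∂μ) ∂(ν.prod (gaussPi ι)))
      (∫ p : Ω × (ι → ℝ),
        (β' s₀ * (∫ x, d p.1 x ∂(μ.tilted
            (fieldEnergy v c d (fun a => ρ a s₀) (β s₀) p.1 p.2))) +
          ∑ a, ρ' a s₀ * (ρ a s₀ * (∫ x, v p.1 x a ^ 2 ∂(μ.tilted
            (fieldEnergy v c d (fun a => ρ a s₀) (β s₀) p.1 p.2)) -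
            (∫ x, v p.1 x a ∂(μ.tilted
            (fieldEnergy v c d (fun a => ρ a s₀) (β s₀) p.1 p.2))) ^ 2)))
        ∂(ν.prod (gaussPi ι))) s₀ := by
  have hE' : ∀ (s : ℝ) (p : Ω × (ι → ℝ)) (x : X), HasDerivAt
      (fun s => fieldEnergy v c d (fun a => ρ a s) (β s) p.1 p.2 x)
      (fieldEnergy v (fun _ _ => 0) d (fun a => ρ' a s) (β' s) p.1 p.2 x) s := fun s p x => by
    unfold fieldEnergy
    refine ((((HasDerivAt.fun_sum fun a _ => (((hρ a s).mul_const (v p.1 x a)).mul_const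
      (p.2 a))).add_const (c p.1 x))).add ((hβ s).mul_const (d p.1 x))).congr_deriv ?_
    simp
  -- The derivative of the energy along the path is again a field energy, with `c = 0`, so the
  -- measurability and size estimates apply to it unchanged.
  have h0 : FieldBound v (fun _ _ => 0) d C :=
    { h with
      measurable_c := measurable_const
      abs_c_le := fun ω x => by simpa using (abs_nonneg _).trans (h.abs_c_le ω x) }
  set r : ι → ℝ := fun a => ρ a s₀ with hr_def
  have hr : ∀ a, |r a| ≤ 1 := fun a => hρ1 a s₀
  have hb := hβ1 s₀
  have step := (hasDerivAt_integral_of_dominated_loc_of_deriv_le (μ := ν.prod (gaussPi ι))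
    (F := fun s p => Real.log (∫ x, Real.exp
        (fieldEnergy v c d (fun a => ρ a s) (β s) p.1 p.2 x) ∂μ))
    (F' := fun s p => ∫ x, fieldEnergy v (fun _ _ => 0) d (fun a => ρ' a s) (β' s) p.1 p.2 x
      ∂(μ.tilted (fieldEnergy v c d (fun a => ρ a s) (β s) p.1 p.2)))
    (x₀ := s₀) (s := Set.univ) (bound := fun p => C * (∑ a, |p.2 a| + 2)) Filter.univ_mem
    (.of_forall fun s => (h.measurable_logPartition μ _ _).aestronglyMeasurable)
    (h.integrable_logPartition μ ν hr hb)
    (measurable_integral_tilted (h.measurable_energy _ _)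
      (h0.measurable_energy _ _)).aestronglyMeasurable
    (.of_forall fun p s _ => h.abs_gibbs_le μ
      (h0.abs_energy_le (fun a => hρ1' a s) (hβ1' s) p.1 p.2) (fun a => hρ1 a s) (hβ1 s) _ _)
    (integrable_sum_abs_gaussPi ν C 2)
    (.of_forall fun p s _ => hasDerivAt_log_integral_exp (C := C * (∑ a, |p.2 a| + 2))
      (C' := C * (∑ a, |p.2 a| + 2))
      (H' := fun s => fieldEnergy v (fun _ _ => 0) d (fun a => ρ' a s) (β' s) p.1 p.2)
      (fun s => h.measurable_energy_right _ _ _ _) (fun s => h0.measurable_energy_right _ _ _ _)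
      (fun s _ => h.abs_energy_le (fun a => hρ1 a s) (hβ1 s) p.1 p.2)
      (fun s _ => h0.abs_energy_le (fun a => hρ1' a s) (hβ1' s) p.1 p.2)
      fun s x => hE' s p x)).2
  refine step.congr_deriv ?_
  have hvb := fun p : Ω × (ι → ℝ) => fun a =>
    h.abs_gibbs_le μ (fun x => h.abs_v_le p.1 x a) hr hb p.1 p.2
  have hvb2 := fun p : Ω × (ι → ℝ) => fun a =>
    h.abs_gibbs_le μ (f := fun x => v p.1 x a ^ 2) (K := C ^ 2) (fun x => by
      rw [abs_pow]; exact pow_le_pow_left₀ (abs_nonneg _) (h.abs_v_le p.1 x a) 2) hr hb p.1 p.2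
  have hvm := fun a => h.measurable_gibbs μ (f := fun ω x => v ω x a) (h.measurable_v a) r (β s₀)
  have hvm2 := fun a => h.measurable_gibbs μ (f := fun ω x => v ω x a ^ 2)
    ((h.measurable_v a).pow_const 2) r (β s₀)
  have hdm := h.measurable_gibbs μ (f := d) h.measurable_d r (β s₀)
  have hdb := fun p : Ω × (ι → ℝ) => h.abs_gibbs_le μ (fun x => h.abs_d_le p.1 x) hr hb p.1 p.2
  have hdi : Integrable (fun p : Ω × (ι → ℝ) => β' s₀ * ∫ x, d p.1 x ∂(μ.tilted
      (fieldEnergy v c d r (β s₀) p.1 p.2))) (ν.prod (gaussPi ι)) :=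
    (integrable_of_abs_le hdm hdb).const_mul _
  have hgi : ∀ a, Integrable (fun p : Ω × (ι → ℝ) => p.2 a * ∫ x, v p.1 x a ∂(μ.tilted
      (fieldEnergy v c d r (β s₀) p.1 p.2))) (ν.prod (gaussPi ι)) := fun a => by
    refine (((integrable_coord_gaussPi a).comp_snd ν).mul_const C).mono'
      (by have := hvm a; fun_prop) (.of_forall fun p => ?_)
    rw [Real.norm_eq_abs, abs_mul]
    exact mul_le_mul_of_nonneg_left (hvb p a) (abs_nonneg _)
  have hsi : ∀ a, Integrable (fun p : Ω × (ι → ℝ) => r a * (∫ x, v p.1 x a ^ 2 ∂(μ.tilted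
      (fieldEnergy v c d r (β s₀) p.1 p.2)) - (∫ x, v p.1 x a ∂(μ.tilted
      (fieldEnergy v c d r (β s₀) p.1 p.2))) ^ 2)) (ν.prod (gaussPi ι)) := fun a => by
    refine Integrable.const_mul (Integrable.sub (integrable_of_abs_le (hvm2 a) (hvb2 · a))
      (integrable_of_abs_le (C := C ^ 2) ((hvm a).pow_const 2) fun p => ?_)) _
    rw [abs_pow]
    exact pow_le_pow_left₀ (abs_nonneg _) (hvb p a) 2
  -- By linearity, the noise enters the derivative only through products of `p.2 a` with a Gibbs
  -- average of `v`, which is the form that integration by parts handles.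
  have e1 : ∀ p : Ω × (ι → ℝ),
      ∫ x, fieldEnergy v (fun _ _ => 0) d (fun a => ρ' a s₀) (β' s₀) p.1 p.2 x
        ∂(μ.tilted (fieldEnergy v c d r (β s₀) p.1 p.2)) =
      β' s₀ * (∫ x, d p.1 x ∂(μ.tilted (fieldEnergy v c d r (β s₀) p.1 p.2))) +
      ∑ a, ρ' a s₀ * (p.2 a * ∫ x, v p.1 x a ∂(μ.tilted
        (fieldEnergy v c d r (β s₀) p.1 p.2))) := fun p => by
    have := isProbabilityMeasure_tilted (integrable_exp_of_abs_le (ν := μ)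
      (h.measurable_energy_right r (β s₀) p.1 p.2) (h.abs_energy_le hr hb p.1 p.2))
    have hxm : ∀ a, Measurable fun x => v p.1 x a := fun a =>
      (h.measurable_v a).comp measurable_prodMk_left
    have hxd : Measurable fun x => d p.1 x := h.measurable_d.comp measurable_prodMk_left
    unfold fieldEnergy
    simp only [add_zero]
    rw [integral_add, integral_finsetSum, integral_const_mul, add_comm]
    · congr 1
      refine Finset.sum_congr rfl fun a _ => ?_
      rw [integral_mul_const, integral_const_mul]
      ring
    · exact fun a _ => ((integrable_of_abs_le (hxm a) (h.abs_v_le p.1 · a)).const_mul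
        _).mul_const _
    · exact integrable_finsetSum _ fun a _ =>
        ((integrable_of_abs_le (hxm a) (h.abs_v_le p.1 · a)).const_mul _).mul_const _
    · exact (integrable_of_abs_le hxd (h.abs_d_le p.1 ·)).const_mul _
  refine (integral_congr_ae (.of_forall e1)).trans ?_
  rw [integral_add hdi (integrable_finsetSum _ fun a _ => (hgi a).const_mul _),
    integral_add hdi (integrable_finsetSum _ fun a _ => (hsi a).const_mul _),
    integral_finsetSum _ fun a _ => (hgi a).const_mul _,
    integral_finsetSum _ fun a _ => (hsi a).const_mul _]
  congr 1
  refine Finset.sum_congr rfl fun a _ => ?_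
  rw [integral_const_mul, integral_const_mul, integral_prod _ (hgi a), integral_prod _ (hsi a)]
  congr 1
  refine integral_congr_ae (.of_forall fun ω => ?_)
  exact h.integral_coord_mul_gibbs μ hr hb ω a

end Interpolation

/-! ### The Nishimori identity -/

section Nishimori

variable {X G : Type*} [MeasurableSpace X] [MeasurableSpace G] {μ : Measure X}
  [IsProbabilityMeasure μ] {γ : Measure G} [IsProbabilityMeasure γ] {T : X → G → G}
  {L : X → G → ℝ}

/-- Averaging over the signal and the observation amounts to weighting pure noise by the
likelihood `exp (L x g)`. -/
lemma integral_planted (hT : ∀ x, Measurable (T x)) (hL : Measurable fun p : X × G => L p.1 p.2)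
    (hTL : ∀ x, γ.map (T x) = γ.withDensity fun g => ENNReal.ofReal (Real.exp (L x g)))
    {F : X → G → ℝ} (hF : Measurable fun p : X × G => F p.1 p.2)
    (hi : Integrable (fun p : X × G => F p.1 p.2 * Real.exp (L p.1 p.2)) (μ.prod γ)) :
    ∫ x, ∫ g, F x (T x g) ∂γ ∂μ = ∫ g, ∫ x, F x g * Real.exp (L x g) ∂μ ∂γ := by
  rw [integral_integral_swap (f := fun g x => F x g * Real.exp (L x g)) hi.swap]
  refine integral_congr_ae (.of_forall fun x => ?_)
  have hLx : Measurable (L x) := hL.comp measurable_prodMk_left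
  have hFx : Measurable (F x) := hF.comp measurable_prodMk_left
  have e := integral_map (hT x).aemeasurable (f := F x) (μ := γ) hFx.aestronglyMeasurable
  simp only
  rw [← e, hTL x, integral_withDensity_eq_integral_toReal_smul (by fun_prop)
    (.of_forall fun g => ENNReal.ofReal_lt_top)]
  refine integral_congr_ae (.of_forall fun g => ?_)
  simp only [smul_eq_mul, ENNReal.toReal_ofReal (Real.exp_pos _).le]
  ring

/-- For each `x` the likelihood is the density of a probability law, that of `T x`, hence has mass
one. -/
lemma integrable_likelihood (hT : ∀ x, Measurable (T x))
    (hL : Measurable fun p : X × G => L p.1 p.2)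
    (hTL : ∀ x, γ.map (T x) = γ.withDensity fun g => ENNReal.ofReal (Real.exp (L x g))) :
    Integrable (fun p : X × G => Real.exp (L p.1 p.2)) (μ.prod γ) := by
  refine ⟨(Real.measurable_exp.comp hL).aestronglyMeasurable, ?_⟩
  rw [hasFiniteIntegral_iff_ofReal (.of_forall fun _ => (Real.exp_pos _).le),
    lintegral_prod _ (by fun_prop)]
  have : ∀ x, ∫⁻ g, ENNReal.ofReal (Real.exp (L x g)) ∂γ = 1 := fun x => by
    rw [← setLIntegral_univ, ← withDensity_apply _ .univ, ← hTL x,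
      Measure.map_apply (hT x) .univ]
    simp
  simp [this]

/-- With k the posterior mean of `φ` and Z the normalizing constant, `integral_planted` turns the
left side into an integral of k · ∫ φ exp L and the right side into one of k² · Z. These agree
because k · Z = ∫ φ exp L: given the observation, the signal is distributed as a posterior sample.
-/
lemma integral_mul_gibbs_eq_integral_sq (hT : ∀ x, Measurable (T x))
    (hL : Measurable fun p : X × G => L p.1 p.2)
    (hTL : ∀ x, γ.map (T x) = γ.withDensity fun g => ENNReal.ofReal (Real.exp (L x g)))
    (hLx : ∀ g, Integrable (fun x => Real.exp (L x g)) μ)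
    {φ : X → ℝ} {K : ℝ} (hφ : Measurable φ) (hK : ∀ x, |φ x| ≤ K) :
    ∫ x, ∫ g, φ x * (∫ y, φ y ∂(μ.tilted fun y => L y (T x g))) ∂γ ∂μ =
      ∫ x, ∫ g, (∫ y, φ y ∂(μ.tilted fun y => L y (T x g))) ^ 2 ∂γ ∂μ := by
  set k : G → ℝ := fun g => ∫ y, φ y ∂(μ.tilted fun y => L y g) with hk
  have hkm : Measurable k := measurable_integral_tilted (H := fun g y => L y g)
    (f := fun _ y => φ y) (hL.comp measurable_swap) (hφ.comp measurable_snd)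
  have hkb : ∀ g, |k g| ≤ K := fun g => by
    have := isProbabilityMeasure_tilted (hLx g)
    simpa using norm_integral_le_of_norm_le_const (μ := μ.tilted fun y => L y g) (f := φ)
      (C := K) (.of_forall hK)
  have hLi := integrable_likelihood (μ := μ) hT hL hTL
  have e1 := integral_planted (μ := μ) hT hL hTL (F := fun x g => φ x * k g) (by fun_prop)
    (hLi.bdd_mul (c := K * K) (by fun_prop) (.of_forall fun p => by
      rw [Real.norm_eq_abs, abs_mul]
      exact mul_le_mul (hK _) (hkb _) (abs_nonneg _) ((abs_nonneg _).trans (hK p.1))))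
  have e2 := integral_planted (μ := μ) hT hL hTL (F := fun _ g => k g ^ 2) (by fun_prop)
    (hLi.bdd_mul (c := K ^ 2) ((hkm.comp measurable_snd).pow_const 2).aestronglyMeasurable (.of_forall fun p => by
      rw [Real.norm_eq_abs, abs_pow]
      exact pow_le_pow_left₀ (abs_nonneg _) (hkb _) 2))
  refine e1.trans (Eq.trans ?_ e2.symm)
  refine integral_congr_ae (.of_forall fun g => ?_)
  have hpos : 0 < ∫ x, Real.exp (L x g) ∂μ := integral_exp_pos (hLx g)
  have hkg : k g * ∫ x, Real.exp (L x g) ∂μ = ∫ x, φ x * Real.exp (L x g) ∂μ := by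
    simp only [hk]
    rw [integral_tilted_eq_div, div_mul_cancel₀ _ hpos.ne']
  simp only [mul_right_comm _ (k g)]
  rw [integral_mul_const, integral_const_mul, ← hkg]
  ring

end Nishimori

/-! ### A positivity property of overlaps -/

/-- A square of a Gibbs average is an average over two independent replicas, so the double sum is
the two-replica mean of (∑ e_k y_k y'_k)². -/
lemma sum_sq_integral_mul_nonneg {X κ : Type*} [MeasurableSpace X] [Fintype κ] {τ : Measure X}
    [IsProbabilityMeasure τ] {y : κ → X → ℝ} {C : ℝ} (hm : ∀ k, Measurable (y k))
    (hC : ∀ k x, |y k x| ≤ C) (e : κ → ℝ) :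
    0 ≤ ∑ k, ∑ l, e k * e l * (∫ x, y k x * y l x ∂τ) ^ 2 := by
  have hint : ∀ k l, Integrable (fun p : X × X => e k * e l * ((y k p.1 * y l p.1) *
      (y k p.2 * y l p.2))) (τ.prod τ) := fun k l => by
    have hi : Integrable (fun x => y k x * y l x) τ :=
      integrable_of_abs_le (C := C * C) ((hm k).mul (hm l)) fun x => by
        rw [abs_mul]
        exact mul_le_mul (hC k x) (hC l x) (abs_nonneg _) ((abs_nonneg _).trans (hC k x))
    exact (hi.mul_prod hi).const_mul _
  have key : ∑ k, ∑ l, e k * e l * (∫ x, y k x * y l x ∂τ) ^ 2 =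
      ∫ p : X × X, (∑ k, e k * (y k p.1 * y k p.2)) ^ 2 ∂(τ.prod τ) := by
    have : ∀ p : X × X, (∑ k, e k * (y k p.1 * y k p.2)) ^ 2 =
        ∑ k, ∑ l, e k * e l * ((y k p.1 * y l p.1) * (y k p.2 * y l p.2)) := fun p => by
      rw [pow_two, Finset.sum_mul_sum]
      exact Finset.sum_congr rfl fun k _ => Finset.sum_congr rfl fun l _ => by ring
    simp only [this]
    rw [integral_finsetSum _ fun k _ => integrable_finsetSum _ fun l _ => hint k l]
    refine Finset.sum_congr rfl fun k _ => ?_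
    rw [integral_finsetSum _ fun l _ => hint k l]
    refine Finset.sum_congr rfl fun l _ => ?_
    rw [integral_const_mul, integral_prod_mul (fun x => y k x * y l x) (fun x => y k x * y l x),
      pow_two]
  rw [key]
  exact integral_nonneg fun p => sq_nonneg _

/-- With `R₁₂ = N⁻¹ ∑ x_i x'_i` the overlap of two replicas, `⟨(R₁₂ - s s')²⟩ ≥ 0` expanded. -/
lemma two_mul_sum_sq_le {X : Type*} [MeasurableSpace X] {τ : Measure X} [IsProbabilityMeasure τ]
    {N : ℕ} {y : X → Fin N → ℝ} {s : X → ℝ} {C : ℝ}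
    (hy : ∀ i, Measurable fun x => y x i) (hs : Measurable s) (hyC : ∀ x i, |y x i| ≤ C)
    (hsC : ∀ x, |s x| ≤ C) :
    2 * N * ∑ i, (∫ x, s x * y x i ∂τ) ^ 2 ≤
      ∑ i, ∑ j, (∫ x, y x i * y x j ∂τ) ^ 2 + N ^ 2 * (∫ x, s x ^ 2 ∂τ) ^ 2 := by
  -- The index `none` carries the extra variable `s` with weight -N. The square expanded here is (∑
  -- y_i y'_i - N s s')².
  have h := sum_sq_integral_mul_nonneg (τ := τ) (κ := Option (Fin N))
    (y := fun k x => k.elim (s x) (y x)) (C := C) (fun k => by cases k <;> simp [hs, hy])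
    (fun k x => by cases k <;> simp [hsC, hyC]) fun k => k.elim (-(N : ℝ)) fun _ => 1
  simp only [Fintype.sum_option, Option.elim] at h
  have e : ∀ i, ∫ x, y x i * s x ∂τ = ∫ x, s x * y x i ∂τ := fun i => by simp only [mul_comm]
  simp only [e, Finset.sum_add_distrib, ← Finset.mul_sum, ← pow_two] at h
  simp only [one_mul, mul_one, one_pow] at h
  have e2 : (-(N : ℝ)) * (-N) = N ^ 2 := by ring
  nlinarith [h]

/-! ### The interpolating field -/

lemma sum_upperIndex {N : ℕ} (F : Fin N → Fin N → ℝ) :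
    ∑ p : UpperIndex N, (if p.1.1 < p.1.2 then F p.1.1 p.1.2 else 0) =
      ∑ i, ∑ j ∈ Finset.Ioi i, F i j := by
  have h1 : ∑ p : UpperIndex N, (if p.1.1 < p.1.2 then F p.1.1 p.1.2 else 0) =
      ∑ p : Fin N × Fin N, if p.1 < p.2 then F p.1 p.2 else 0 := by
    rw [← Finset.sum_filter_of_ne (s := Finset.univ) (p := fun p : Fin N × Fin N => p.1 ≤ p.2)
      (fun p _ h => by
        by_contra hp
        exact h (if_neg fun hlt => hp hlt.le))]
    exact (Finset.sum_subtype (p := fun p : Fin N × Fin N => p.1 ≤ p.2)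
      (Finset.univ.filter fun p : Fin N × Fin N => p.1 ≤ p.2) (fun p => by simp)
      fun p => if p.1 < p.2 then F p.1 p.2 else 0).symm
  rw [h1, Fintype.sum_prod_type]
  refine Finset.sum_congr rfl fun i _ => ?_
  rw [← Finset.sum_filter]
  exact Finset.sum_congr (by ext j; simp) fun _ _ => rfl

lemma two_mul_sum_Ioi {N : ℕ} (F : Fin N → Fin N → ℝ) (hF : ∀ i j, F i j = F j i) :
    2 * ∑ i, ∑ j ∈ Finset.Ioi i, F i j = ∑ i, ∑ j, F i j - ∑ i, F i i := by
  have h1 : ∀ i j : Fin N, F i j = (if i < j then F i j else 0) + (if j < i then F j i else 0) +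
      if i = j then F i i else 0 := fun i j => by
    rcases lt_trichotomy i j with h | h | h
    · simp [h, h.ne, h.not_gt]
    · subst h; simp
    · simp [h, h.ne', h.not_gt, hF i j]
  have h2 : ∑ i, ∑ j, (if i < j then F i j else 0) = ∑ i, ∑ j ∈ Finset.Ioi i, F i j :=
    Finset.sum_congr rfl fun i _ => by
      rw [← Finset.sum_filter]
      exact Finset.sum_congr (by ext j; simp) fun _ _ => rfl
  have h3 : ∑ i, ∑ j, F i j = ∑ i, ∑ j, ((if i < j then F i j else 0) +
      (if j < i then F j i else 0) + if i = j then F i i else 0) :=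
    Finset.sum_congr rfl fun i _ => Finset.sum_congr rfl fun j _ => h1 i j
  rw [h3]
  simp only [Finset.sum_add_distrib]
  rw [Finset.sum_comm (f := fun i j => if j < i then F j i else 0), h2]
  simp
  ring

section Field

variable {N : ℕ} (lam : ℝ) (f : ℝ → ℝ)

/-- `∑ x_i x*_i`, for configurations transformed by `f`. -/
def innerSum (xs x : Fin N → ℝ) : ℝ := ∑ i, f (x i) * f (xs i)

/-- The coefficients of the matrix noise. -/
def pairField (x : Fin N → ℝ) (p : UpperIndex N) : ℝ :=
  if p.1.1 < p.1.2 then √(lam / N) * (f (x p.1.1) * f (x p.1.2)) else 0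

/-- The drift of the matrix channel. -/
def pairDrift (xs x : Fin N → ℝ) : ℝ :=
  ∑ p : UpperIndex N, if p.1.1 < p.1.2 then
    lam / N * ((f (x p.1.1) * f (xs p.1.1)) * (f (x p.1.2) * f (xs p.1.2))) -
      lam / (2 * N) * (f (x p.1.1) * f (x p.1.2)) ^ 2 else 0

variable (m pen : (Fin N → ℝ) → (Fin N → ℝ) → ℝ)

/-- The coefficients of the noise of the matrix channel and of the scalar channels with
strength `m`. -/
def interpField (xs x : Fin N → ℝ) : UpperIndex N ⊕ Fin N → ℝ :=
  Sum.elim (pairField lam f x) fun i => √lam * (√|m xs x| * f (x i))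

/-- The drift of the scalar channels, with a penalty. -/
def scalarDrift (xs x : Fin N → ℝ) : ℝ :=
  lam * (m xs x * innerSum f xs x) - lam / 2 * (|m xs x| * ∑ i, f (x i) ^ 2) - pen xs x

/-- The trigonometric amplitudes of the interpolation. -/
def amplitude (s : ℝ) : UpperIndex N ⊕ Fin N → ℝ :=
  Sum.elim (fun _ => Real.sin s) fun _ => Real.cos s

/-- The interpolating Hamiltonian. -/
def interpEnergy (s : ℝ) :
    (Fin N → ℝ) → (UpperIndex N ⊕ Fin N → ℝ) → (Fin N → ℝ) → ℝ :=
  fieldEnergy (interpField lam f m) (scalarDrift lam f m pen)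
    (fun xs x => pairDrift lam f xs x - scalarDrift lam f m pen xs x)
    (amplitude s) (Real.sin s ^ 2)

variable {lam f m pen}

lemma sum_pairField_sq (hlam : 0 ≤ lam) (x : Fin N → ℝ) :
    ∑ p, pairField lam f x p ^ 2 =
      ∑ p : UpperIndex N, if p.1.1 < p.1.2 then
        lam / N * (f (x p.1.1) * f (x p.1.2)) ^ 2 else 0 := by
  refine Finset.sum_congr rfl fun p _ => ?_
  unfold pairField
  split_ifs
  · rw [mul_pow, Real.sq_sqrt (by positivity)]
  · simp

/-- Integration by parts adds half the squared field to the drift. It cancels the quadratic term in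
`x` and leaves a function of the overlap with the signal, up to the diagonal. -/
lemma pairDrift_add (hlam : 0 ≤ lam) (xs x : Fin N → ℝ) :
    pairDrift lam f xs x + 1 / 2 * ∑ p, pairField lam f x p ^ 2 =
      lam / (2 * N) * (innerSum f xs x ^ 2 - ∑ i, (f (x i) * f (xs i)) ^ 2) := by
  have h := two_mul_sum_Ioi (fun i j : Fin N => (f (x i) * f (xs i)) * (f (x j) * f (xs j)))
    fun i j => mul_comm _ _
  rw [← sum_upperIndex, ← Finset.sum_mul_sum] at h
  rw [sum_pairField_sq hlam, pairDrift, Finset.mul_sum, ← Finset.sum_add_distrib, innerSum]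
  have e : ∀ p : UpperIndex N, ((if p.1.1 < p.1.2 then
      lam / N * ((f (x p.1.1) * f (xs p.1.1)) * (f (x p.1.2) * f (xs p.1.2))) -
        lam / (2 * N) * (f (x p.1.1) * f (x p.1.2)) ^ 2 else 0) +
      1 / 2 * if p.1.1 < p.1.2 then lam / N * (f (x p.1.1) * f (x p.1.2)) ^ 2 else 0) =
      lam / N * if p.1.1 < p.1.2 then
        (f (x p.1.1) * f (xs p.1.1)) * (f (x p.1.2) * f (xs p.1.2)) else 0 := fun p => by
    split_ifs
    · rw [show lam / (2 * (N : ℝ)) = lam / N / 2 by rw [div_div, mul_comm]]; ring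
    · simp
  simp only [e, ← Finset.mul_sum]
  rw [show lam / (2 * (N : ℝ)) = lam / N / 2 by rw [div_div, mul_comm]]
  simp only [pow_two]
  linear_combination lam / N / 2 * h

lemma scalarDrift_add (hlam : 0 ≤ lam) (xs x : Fin N → ℝ) :
    scalarDrift lam f m pen xs x + 1 / 2 * ∑ i, (√lam * (√|m xs x| * f (x i))) ^ 2 =
      lam * (m xs x * innerSum f xs x) - pen xs x := by
  have : ∑ i, (√lam * (√|m xs x| * f (x i))) ^ 2 = lam * (|m xs x| * ∑ i, f (x i) ^ 2) := by
    rw [Finset.mul_sum, Finset.mul_sum]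
    refine Finset.sum_congr rfl fun i _ => ?_
    rw [mul_pow, mul_pow, Real.sq_sqrt hlam, Real.sq_sqrt (abs_nonneg _)]
  rw [this, scalarDrift]
  ring

variable {B C : ℝ}

lemma abs_innerSum_le (hB : ∀ x, |f x| ≤ B) (xs x : Fin N → ℝ) :
    |innerSum f xs x| ≤ N * B ^ 2 := by
  refine (Finset.abs_sum_le_sum_abs _ _).trans
    ((Finset.sum_le_sum fun i _ => ?_).trans_eq ?_ (b := ∑ _i : Fin N, B ^ 2))
  · rw [abs_mul, pow_two]
    exact mul_le_mul (hB _) (hB _) (abs_nonneg _) ((abs_nonneg _).trans (hB 0))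
  · simp

lemma measurable_innerSum (hf : Measurable f) :
    Measurable fun p : (Fin N → ℝ) × (Fin N → ℝ) => innerSum f p.1 p.2 := by
  unfold innerSum
  fun_prop

lemma measurable_pairField (hf : Measurable f) (p : UpperIndex N) :
    Measurable fun x : Fin N → ℝ => pairField lam f x p := by
  unfold pairField
  split_ifs <;> fun_prop

lemma measurable_pairDrift (hf : Measurable f) :
    Measurable fun p : (Fin N → ℝ) × (Fin N → ℝ) => pairDrift lam f p.1 p.2 := by
  unfold pairDrift
  refine Finset.measurable_sum _ fun p _ => ?_
  split_ifs <;> fun_prop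

lemma abs_pairField_le (hB : ∀ x, |f x| ≤ B) (x : Fin N → ℝ) (p : UpperIndex N) :
    |pairField lam f x p| ≤ √(lam / N) * (B * B) := by
  have hB0 := (abs_nonneg _).trans (hB 0)
  unfold pairField
  split_ifs
  · rw [abs_mul, abs_mul, abs_of_nonneg (Real.sqrt_nonneg _)]
    gcongr <;> exact hB _
  · rw [abs_zero]; positivity

lemma abs_pairDrift_le (hlam : 0 ≤ lam) (hB : ∀ x, |f x| ≤ B) (xs x : Fin N → ℝ) :
    |pairDrift lam f xs x| ≤
      Fintype.card (UpperIndex N) * (lam / N * (B * B * (B * B)) + lam / (2 * N) * (B * B) ^ 2) := by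
  have hB0 := (abs_nonneg _).trans (hB 0)
  unfold pairDrift
  refine (Finset.abs_sum_le_sum_abs _ _).trans ((Finset.sum_le_card_nsmul _ _ _ fun p _ => ?_).trans_eq
    (nsmul_eq_mul _ _))
  split_ifs
  · refine (abs_sub _ _).trans ?_
    rw [abs_mul, abs_mul (_ * _), abs_of_nonneg (show 0 ≤ lam / N by positivity),
      abs_mul (lam / (2 * N)), abs_of_nonneg (show 0 ≤ lam / (2 * N) by positivity), abs_mul,
      abs_mul, abs_pow, abs_mul]
    gcongr <;> exact hB _
  · rw [abs_zero]; positivity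

/-- Hypotheses on the strength and the penalty of the scalar channels. -/
structure ChannelBound (m pen : (Fin N → ℝ) → (Fin N → ℝ) → ℝ) (C : ℝ) : Prop where
  measurable_m : Measurable fun p : (Fin N → ℝ) × (Fin N → ℝ) => m p.1 p.2
  measurable_pen : Measurable fun p : (Fin N → ℝ) × (Fin N → ℝ) => pen p.1 p.2
  abs_m_le : ∀ xs x, |m xs x| ≤ C
  abs_pen_le : ∀ xs x, |pen xs x| ≤ C

lemma ChannelBound.exists_fieldBound (h : ChannelBound m pen C) (hlam : 0 ≤ lam)
    (hf : Measurable f) (hB : ∀ x, |f x| ≤ B) :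
    ∃ K, FieldBound (interpField lam f m) (scalarDrift lam f m pen)
      (fun xs x => pairDrift lam f xs x - scalarDrift lam f m pen xs x) K := by
  have hB0 := (abs_nonneg _).trans (hB 0)
  have hmm := h.measurable_m
  have hC0 : 0 ≤ C := (abs_nonneg _).trans (h.abs_m_le 0 0)
  have hpm := h.measurable_pen
  have hsd : ∀ xs x, |scalarDrift lam f m pen xs x| ≤
      lam * (C * (N * B ^ 2)) + lam / 2 * (C * (N * B ^ 2)) + C := fun xs x => by
    unfold scalarDrift
    refine (abs_sub _ _).trans (add_le_add ((abs_sub _ _).trans (add_le_add ?_ ?_))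
      (h.abs_pen_le xs x))
    · rw [abs_mul, abs_mul, abs_of_nonneg hlam]
      gcongr
      · exact h.abs_m_le xs x
      · exact abs_innerSum_le hB xs x
    · rw [abs_mul, abs_mul, abs_abs, abs_of_nonneg (show 0 ≤ lam / 2 by positivity),
        abs_of_nonneg (Finset.sum_nonneg (f := fun i => f (x i) ^ 2) fun i _ => sq_nonneg _)]
      gcongr
      · exact h.abs_m_le xs x
      · refine (Finset.sum_le_card_nsmul _ _ (B ^ 2) fun i _ => ?_).trans_eq (by simp)
        exact sq_le_sq' (neg_le_of_abs_le (hB _)) (le_of_abs_le (hB _))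
  have hsdm : Measurable fun p : (Fin N → ℝ) × (Fin N → ℝ) =>
      scalarDrift lam f m pen p.1 p.2 := by
    have := measurable_innerSum (N := N) hf
    unfold scalarDrift
    exact (((hmm.mul this).const_mul lam).sub (((continuous_abs.measurable.comp hmm).mul
      (by fun_prop)).const_mul _)).sub hpm
  set K1 := √(lam / N) * (B * B)
  set K2 := √lam * (√C * B)
  set K3 := Fintype.card (UpperIndex N) *
    (lam / N * (B * B * (B * B)) + lam / (2 * N) * (B * B) ^ 2)
  set K4 := lam * (C * (N * B ^ 2)) + lam / 2 * (C * (N * B ^ 2)) + C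
  have hK1 : 0 ≤ K1 := by positivity
  have hK2 : 0 ≤ K2 := by positivity
  have hK3 : 0 ≤ K3 := by positivity
  have hK4 : 0 ≤ K4 := by positivity
  refine ⟨K1 + K2 + K3 + K4, ⟨?_, hsdm, (measurable_pairDrift hf).sub hsdm, ?_, ?_, ?_⟩⟩
  · rintro (p | i)
    · exact (measurable_pairField hf p).comp measurable_snd
    · simp only [interpField, Sum.elim_inr]
      exact (((continuous_abs.measurable.comp hmm).sqrt).mul (by fun_prop)).const_mul _
  · rintro xs x (p | i)
    · have := abs_pairField_le (lam := lam) hB x p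
      simp only [interpField, Sum.elim_inl]
      linarith
    · have : |√lam * (√|m xs x| * f (x i))| ≤ K2 := by
        rw [abs_mul, abs_mul, abs_of_nonneg (Real.sqrt_nonneg _),
          abs_of_nonneg (Real.sqrt_nonneg _)]
        have := h.abs_m_le xs x
        exact mul_le_mul_of_nonneg_left (mul_le_mul (Real.sqrt_le_sqrt this) (hB _)
          (abs_nonneg _) (Real.sqrt_nonneg _)) (Real.sqrt_nonneg _)
      simp only [interpField, Sum.elim_inr]
      linarith
  · intro xs x
    have := hsd xs x
    linarith
  · intro xs x
    have := hsd xs x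
    have h2 := abs_pairDrift_le hlam hB xs x
    have := abs_sub (pairDrift lam f xs x) (scalarDrift lam f m pen xs x)
    linarith

/-- The Gibbs average entering the derivative of the interpolated free entropy. -/
lemma interp_bracket_eq (h : ChannelBound m pen C) (hlam : 0 ≤ lam) (hf : Measurable f)
    (hB : ∀ x, |f x| ≤ B) (xs : Fin N → ℝ) (τ : Measure (Fin N → ℝ)) [IsProbabilityMeasure τ] :
    (∫ x, (pairDrift lam f xs x - scalarDrift lam f m pen xs x) ∂τ) +
      1 / 2 * ∑ p, (∫ x, pairField lam f x p ^ 2 ∂τ - (∫ x, pairField lam f x p ∂τ) ^ 2) -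
      1 / 2 * ∑ i, (∫ x, (√lam * (√|m xs x| * f (x i))) ^ 2 ∂τ -
        (∫ x, √lam * (√|m xs x| * f (x i)) ∂τ) ^ 2) =
    (∫ x, (lam / (2 * N) * innerSum f xs x ^ 2 - lam * (m xs x * innerSum f xs x) + pen xs x) ∂τ) -
      lam / (2 * N) * (∑ i, ∫ x, (f (x i) * f (xs i)) ^ 2 ∂τ) -
      lam / (4 * N) * (∑ i, ∑ j, (∫ x, f (x i) * f (x j) ∂τ) ^ 2) +
      lam / (4 * N) * (∑ i, (∫ x, f (x i) ^ 2 ∂τ) ^ 2) +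
      lam / 2 * ∑ i, (∫ x, √|m xs x| * f (x i) ∂τ) ^ 2 := by
  obtain ⟨K, hK⟩ := h.exists_fieldBound hlam hf hB
  have hB0 := (abs_nonneg _).trans (hB 0)
  have hmx : ∀ {F : (Fin N → ℝ) × (Fin N → ℝ) → ℝ}, Measurable F → Measurable fun x => F (xs, x) :=
    fun {F} hF => hF.comp measurable_prodMk_left
  have hvi : ∀ a, Integrable (fun x => interpField lam f m xs x a ^ 2) τ := fun a =>
    integrable_of_abs_le (C := K ^ 2) (hmx ((hK.measurable_v a).pow_const 2)) fun x => by
      rw [abs_pow]; exact pow_le_pow_left₀ (abs_nonneg _) (hK.abs_v_le xs x a) 2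
  have hpi : ∀ p, Integrable (fun x => pairField lam f x p ^ 2) τ := fun p => hvi (Sum.inl p)
  have hwi : ∀ i, Integrable (fun x : Fin N → ℝ => (√lam * (√|m xs x| * f (x i))) ^ 2) τ :=
    fun i => hvi (Sum.inr i)
  have hdi : Integrable (fun x => pairDrift lam f xs x - scalarDrift lam f m pen xs x) τ :=
    integrable_of_abs_le (hmx hK.measurable_d) (hK.abs_d_le xs)
  have hai : ∀ i, Integrable (fun x : Fin N → ℝ => (f (x i) * f (xs i)) ^ 2) τ := fun i =>
    integrable_of_abs_le (C := (B * B) ^ 2) (by fun_prop) fun x => by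
      rw [abs_pow, abs_mul]
      gcongr <;> exact hB _
  have hdpi : Integrable (fun x => (pairDrift lam f xs x - scalarDrift lam f m pen xs x) +
      1 / 2 * ∑ p, pairField lam f x p ^ 2) τ :=
    hdi.add ((integrable_finsetSum _ fun p _ => hpi p).const_mul _)
  have hsum : (∫ x, (pairDrift lam f xs x - scalarDrift lam f m pen xs x) ∂τ) +
      1 / 2 * ∑ p, (∫ x, pairField lam f x p ^ 2 ∂τ) -
      1 / 2 * ∑ i, (∫ x, (√lam * (√|m xs x| * f (x i))) ^ 2 ∂τ) =
      (∫ x, (lam / (2 * N) * innerSum f xs x ^ 2 - lam * (m xs x * innerSum f xs x) +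
        pen xs x) ∂τ) - lam / (2 * N) * (∑ i, ∫ x, (f (x i) * f (xs i)) ^ 2 ∂τ) := by
    rw [← integral_finsetSum _ fun p _ => hpi p,
      ← integral_finsetSum _ fun i _ => hwi i,
      ← integral_finsetSum _ fun i _ => hai i, ← integral_const_mul, ← integral_const_mul,
      ← integral_const_mul, ← integral_add hdi
        ((integrable_finsetSum _ fun p _ => hpi p).const_mul _),
      ← integral_sub hdpi ((integrable_finsetSum _ fun i _ => hwi i).const_mul _),
      ← integral_sub _ ((integrable_finsetSum _ fun i _ => hai i).const_mul _)]
    · refine integral_congr_ae (.of_forall fun x => ?_)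
      have h1 := pairDrift_add (f := f) hlam xs x
      have h2 := scalarDrift_add (f := f) (m := m) (pen := pen) hlam xs x
      linarith
    · have hi := measurable_innerSum (N := N) hf
      refine integrable_of_abs_le (C := lam / (2 * N) * (N * B ^ 2) ^ 2 +
        lam * (C * (N * B ^ 2)) + C) (hmx (((hi.pow_const 2).const_mul _).sub
          ((h.measurable_m.mul hi).const_mul _) |>.add h.measurable_pen)) fun x => ?_
      have hC0 : 0 ≤ C := (abs_nonneg _).trans (h.abs_m_le 0 0)
      refine (abs_add_le _ _).trans (add_le_add ((abs_sub _ _).trans (add_le_add ?_ ?_))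
        (h.abs_pen_le xs x))
      · rw [abs_mul, abs_pow, abs_of_nonneg (show 0 ≤ lam / (2 * N) by positivity)]
        gcongr
        exact abs_innerSum_le hB xs x
      · rw [abs_mul, abs_mul, abs_of_nonneg hlam]
        gcongr
        · exact h.abs_m_le xs x
        · exact abs_innerSum_le hB xs x
  have hp : ∑ p, (∫ x, pairField lam f x p ∂τ) ^ 2 = lam / (2 * N) *
      (∑ i, ∑ j, (∫ x, f (x i) * f (x j) ∂τ) ^ 2 - ∑ i, (∫ x, f (x i) ^ 2 ∂τ) ^ 2) := by
    have h1 := two_mul_sum_Ioi (fun i j : Fin N => (∫ x, f (x i) * f (x j) ∂τ) ^ 2)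
      fun i j => by simp only [mul_comm]
    rw [← sum_upperIndex] at h1
    have h2 : ∀ p : UpperIndex N, (∫ x, pairField lam f x p ∂τ) ^ 2 = lam / N *
        if p.1.1 < p.1.2 then (∫ x, f (x p.1.1) * f (x p.1.2) ∂τ) ^ 2 else 0 := fun p => by
      unfold pairField
      split_ifs
      · rw [integral_const_mul, mul_pow, Real.sq_sqrt (by positivity)]
      · simp
    simp only [h2, ← Finset.mul_sum]
    rw [show lam / (2 * (N : ℝ)) = lam / N / 2 by rw [div_div, mul_comm]]
    simp only [← pow_two] at h1
    linear_combination lam / N / 2 * h1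
  have hw : ∑ i, (∫ x, √lam * (√|m xs x| * f (x i)) ∂τ) ^ 2 =
      lam * ∑ i, (∫ x, √|m xs x| * f (x i) ∂τ) ^ 2 := by
    rw [Finset.mul_sum]
    refine Finset.sum_congr rfl fun i _ => ?_
    rw [integral_const_mul, mul_pow, Real.sq_sqrt hlam]
  rw [Finset.sum_sub_distrib, Finset.sum_sub_distrib, hp, hw,
    show lam / (4 * (N : ℝ)) = lam / (2 * N) / 2 by rw [div_div]; ring_nf]
  linear_combination hsum

end Field

/-! ### The derivative along the path, and the upper bound with configuration-dependent strength -/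

/-- Since 2 sin s cos s is the nonnegative derivative of sin² s on the quarter period, the function
F - K sin² decreases there. -/
lemma le_add_of_hasDerivAt_sin_cos {F D : ℝ → ℝ} {K : ℝ}
    (hF : ∀ s, HasDerivAt F (2 * Real.sin s * Real.cos s * D s) s) (hD : ∀ s, D s ≤ K) :
    F (Real.pi / 2) ≤ F 0 + K := by
  have hG : ∀ s, HasDerivAt (fun s => F s - K * Real.sin s ^ 2)
      (2 * Real.sin s * Real.cos s * (D s - K)) s := fun s =>
    ((hF s).sub (((Real.hasDerivAt_sin s).pow 2).const_mul K)).congr_deriv (by simp; ring)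
  have hanti : AntitoneOn (fun s => F s - K * Real.sin s ^ 2) (Set.Icc 0 (Real.pi / 2)) := by
    refine antitoneOn_of_deriv_nonpos (convex_Icc _ _)
      (fun s _ => (hG s).continuousAt.continuousWithinAt)
      (fun s _ => (hG s).differentiableAt.differentiableWithinAt) fun s hs => ?_
    rw [interior_Icc] at hs
    rw [(hG s).deriv]
    have h1 := Real.sin_nonneg_of_nonneg_of_le_pi hs.1.le (by linarith [hs.2, Real.pi_pos])
    have h2 := Real.cos_nonneg_of_neg_pi_div_two_le_of_le (by linarith [hs.1, Real.pi_pos]) hs.2.le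
    exact mul_nonpos_of_nonneg_of_nonpos (by positivity) (by linarith [hD s])
  have hpi := Real.pi_pos
  have := hanti (Set.left_mem_Icc.2 (by positivity)) (Set.right_mem_Icc.2 (by positivity))
    (by positivity)
  simp at this
  linarith

section Derivative

variable {N : ℕ} (P : Measure ℝ) [IsProbabilityMeasure P] (lam : ℝ) (f : ℝ → ℝ)
  (m pen : (Fin N → ℝ) → (Fin N → ℝ) → ℝ)

/-- The mean log-partition function along the interpolation. -/
def interpFree (s : ℝ) : ℝ :=
  ∫ p : (Fin N → ℝ) × (UpperIndex N ⊕ Fin N → ℝ),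
    Real.log (∫ x, Real.exp (interpEnergy lam f m pen s p.1 p.2 x) ∂(Measure.pi fun _ => P))
    ∂((Measure.pi fun _ => P).prod (gaussPi _))

/-- The posterior measure along the interpolation. -/
def interpGibbs (s : ℝ) (p : (Fin N → ℝ) × (UpperIndex N ⊕ Fin N → ℝ)) :
    Measure (Fin N → ℝ) :=
  (Measure.pi fun _ => P).tilted (interpEnergy lam f m pen s p.1 p.2)

/-- The Gibbs average entering the derivative of the interpolated free entropy. -/
def overlapBracket (xs : Fin N → ℝ) (τ : Measure (Fin N → ℝ)) : ℝ :=
  (∫ x, (lam / (2 * N) * innerSum f xs x ^ 2 - lam * (m xs x * innerSum f xs x) + pen xs x) ∂τ) -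
      lam / (2 * N) * (∑ i, ∫ x, (f (x i) * f (xs i)) ^ 2 ∂τ) -
      lam / (4 * N) * (∑ i, ∑ j, (∫ x, f (x i) * f (x j) ∂τ) ^ 2) +
      lam / (4 * N) * (∑ i, (∫ x, f (x i) ^ 2 ∂τ) ^ 2) +
      lam / 2 * ∑ i, (∫ x, √|m xs x| * f (x i) ∂τ) ^ 2

variable {P lam f m pen} {B C : ℝ}

lemma abs_amplitude_le (s : ℝ) (a : UpperIndex N ⊕ Fin N) : |amplitude s a| ≤ 1 := by
  cases a
  · exact Real.abs_sin_le_one s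
  · exact Real.abs_cos_le_one s

lemma abs_sin_sq_le (s : ℝ) : |Real.sin s ^ 2| ≤ 1 := by
  rw [abs_pow]
  exact pow_le_one₀ (abs_nonneg _) (Real.abs_sin_le_one s)

lemma isProbabilityMeasure_interpGibbs (h : ChannelBound m pen C) (hlam : 0 ≤ lam)
    (hf : Measurable f) (hB : ∀ x, |f x| ≤ B) (s : ℝ)
    (p : (Fin N → ℝ) × (UpperIndex N ⊕ Fin N → ℝ)) :
    IsProbabilityMeasure (interpGibbs P lam f m pen s p) := by
  obtain ⟨K, hK⟩ := h.exists_fieldBound hlam hf hB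
  exact isProbabilityMeasure_tilted (integrable_exp_of_abs_le
    (hK.measurable_energy_right (amplitude s) (Real.sin s ^ 2) p.1 p.2)
    (hK.abs_energy_le (abs_amplitude_le s) (abs_sin_sq_le s) p.1 p.2))

/-- The drift weight sin² has derivative 2 sin cos, while an amplitude times its own derivative is
sin cos for the matrix and -sin cos for the scalars. All terms share one factor, and the
trigonometric path avoids the endpoint singularity of square-root amplitudes. -/
lemma hasDerivAt_interpFree (h : ChannelBound m pen C) (hlam : 0 ≤ lam)
    (hf : Measurable f) (hB : ∀ x, |f x| ≤ B) (s : ℝ) :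
    HasDerivAt (interpFree P lam f m pen) (2 * Real.sin s * Real.cos s *
      ∫ p, overlapBracket lam f m pen p.1 (interpGibbs P lam f m pen s p)
        ∂((Measure.pi fun _ => P).prod (gaussPi _))) s := by
  obtain ⟨K, hK⟩ := h.exists_fieldBound hlam hf hB
  have key := hK.hasDerivAt_integral_logPartition (Measure.pi fun _ => P) (Measure.pi fun _ => P)
    (ρ := fun a s => amplitude s a)
    (ρ' := fun a s => Sum.elim (fun _ => Real.cos s) (fun _ => -Real.sin s) a)
    (β := fun s => Real.sin s ^ 2) (β' := fun s => 2 * Real.sin s * Real.cos s)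
    (fun a s => by
      cases a
      · exact Real.hasDerivAt_sin s
      · exact Real.hasDerivAt_cos s)
    (fun s => ((Real.hasDerivAt_sin s).pow 2).congr_deriv (by simp))
    (fun a s => abs_amplitude_le s a)
    (fun a s => by
      cases a
      · exact Real.abs_cos_le_one s
      · simpa using Real.abs_sin_le_one s)
    abs_sin_sq_le
    (fun s => by rw [← Real.sin_two_mul]; exact Real.abs_sin_le_one _) s
  refine key.congr_deriv ?_
  rw [← integral_const_mul]
  refine integral_congr_ae (.of_forall fun p => ?_)
  have := isProbabilityMeasure_interpGibbs (P := P) h hlam hf hB s p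
  have hbr := interp_bracket_eq h hlam hf hB p.1 (interpGibbs P lam f m pen s p)
  simp only [overlapBracket]
  rw [← hbr]
  simp only [Fintype.sum_sum_type, interpField, amplitude, Sum.elim_inl, Sum.elim_inr,
    interpGibbs, interpEnergy, ← Finset.mul_sum]
  ring

/-- Write R = `innerSum f xs x`. Since R is within 1 of N m, the terms lam R²/(2N) - lam m R are at
most lam/2 - lam N m²/2, and the penalty brings this to lam/2 - lam N m²/4. The positive replica
term with √|m| is bounded by two-replica positivity and Jensen: it costs exactly the remaining lam N
m²/4 and the negative sum of squared correlations. Only lam/2 and the diagonal survive. -/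
lemma overlapBracket_le (h : ChannelBound m pen C) (hlam : 0 ≤ lam) (hf : Measurable f)
    (hB : ∀ x, |f x| ≤ B) (hN : 0 < N)
    (hm : ∀ xs x, |innerSum f xs x - N * m xs x| ≤ 1)
    (hpen : ∀ xs x, pen xs x = lam * N / 4 * m xs x ^ 2) (xs : Fin N → ℝ)
    (τ : Measure (Fin N → ℝ)) [IsProbabilityMeasure τ] :
    overlapBracket lam f m pen xs τ ≤ lam * B ^ 4 / 4 + lam / 2 := by
  have hB0 := (abs_nonneg _).trans (hB 0)
  have hC0 : 0 ≤ C := (abs_nonneg _).trans (h.abs_m_le 0 0)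
  have hN' : (0 : ℝ) < N := by exact_mod_cast hN
  have hN1 : (1 : ℝ) ≤ N := by exact_mod_cast hN
  have hmx : Measurable (m xs) := h.measurable_m.comp measurable_prodMk_left
  have hpx : Measurable (pen xs) := h.measurable_pen.comp measurable_prodMk_left
  have hix : Measurable (innerSum f xs) := (measurable_innerSum hf).comp measurable_prodMk_left
  have hm2i : Integrable (fun x => m xs x ^ 2) τ :=
    integrable_of_abs_le (C := C ^ 2) (hmx.pow_const 2) fun x => by
      rw [abs_pow]; exact pow_le_pow_left₀ (abs_nonneg _) (h.abs_m_le xs x) 2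
  have hami : Integrable (fun x => |m xs x|) τ :=
    (integrable_of_abs_le hmx (h.abs_m_le xs)).abs
  have t1 : ∫ x, (lam / (2 * N) * innerSum f xs x ^ 2 - lam * (m xs x * innerSum f xs x) +
      pen xs x) ∂τ ≤ lam / 2 - lam * N / 4 * ∫ x, m xs x ^ 2 ∂τ := by
    have : ∫ x, (lam / 2 - lam * N / 4 * m xs x ^ 2) ∂τ =
        lam / 2 - lam * N / 4 * ∫ x, m xs x ^ 2 ∂τ := by
      rw [integral_sub (integrable_const _) (hm2i.const_mul _), integral_const_mul]
      simp
    rw [← this]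
    refine integral_mono ?_ ((integrable_const _).sub (hm2i.const_mul _)) fun x => ?_
    · refine ((Integrable.const_mul ?_ _).sub (Integrable.const_mul ?_ _)).add
        (integrable_of_abs_le hpx (h.abs_pen_le xs))
      · refine integrable_of_abs_le (C := (N * B ^ 2) ^ 2) (hix.pow_const 2) fun x => ?_
        rw [abs_pow]; exact pow_le_pow_left₀ (abs_nonneg _) (abs_innerSum_le hB xs x) 2
      · refine integrable_of_abs_le (C := C * (N * B ^ 2)) (hmx.mul hix) fun x => ?_
        rw [abs_mul]
        exact mul_le_mul (h.abs_m_le xs x) (abs_innerSum_le hB xs x) (abs_nonneg _) hC0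
    · have h1 : (innerSum f xs x - N * m xs x) ^ 2 ≤ 1 := by
        rw [← sq_abs]; exact pow_le_one₀ (abs_nonneg _) (hm xs x)
      have h2 : lam / (2 * N) * (innerSum f xs x - N * m xs x) ^ 2 ≤ lam / 2 :=
        calc _ ≤ lam / (2 * N) * 1 := by gcongr
          _ ≤ lam / 2 := by
            rw [mul_one]
            exact div_le_div_of_nonneg_left hlam two_pos (by linarith)
      have h3 : lam / (2 * N) * (innerSum f xs x - N * m xs x) ^ 2 =
          lam / (2 * N) * innerSum f xs x ^ 2 - lam * (m xs x * innerSum f xs x) +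
            lam * N / 2 * m xs x ^ 2 := by
        field_simp; ring
      simp only [hpen]
      linarith
  have t2 : 0 ≤ lam / (2 * N) * (∑ i, ∫ x, (f (x i) * f (xs i)) ^ 2 ∂τ) :=
    mul_nonneg (by positivity) (Finset.sum_nonneg fun i _ => integral_nonneg fun x => sq_nonneg _)
  have t3 : lam / (4 * N) * (∑ i, (∫ x, f (x i) ^ 2 ∂τ) ^ 2) ≤ lam * B ^ 4 / 4 := by
    have : ∑ i : Fin N, (∫ x, f (x i) ^ 2 ∂τ) ^ 2 ≤ N * B ^ 4 := by
      refine (Finset.sum_le_card_nsmul _ _ (B ^ 4) fun i _ => ?_).trans_eq (by simp)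
      have hb : |∫ x, f (x i) ^ 2 ∂τ| ≤ B ^ 2 := by
        simpa using norm_integral_le_of_norm_le_const (μ := τ) (f := fun x => f (x i) ^ 2)
          (C := B ^ 2) (.of_forall fun x => by
            rw [Real.norm_eq_abs, abs_pow]; exact pow_le_pow_left₀ (abs_nonneg _) (hB _) 2)
      calc _ = |∫ x, f (x i) ^ 2 ∂τ| ^ 2 := (sq_abs _).symm
        _ ≤ (B ^ 2) ^ 2 := pow_le_pow_left₀ (abs_nonneg _) hb 2
        _ = B ^ 4 := by ring
    calc _ ≤ lam / (4 * N) * (N * B ^ 4) := by gcongr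
      _ = lam * B ^ 4 / 4 := by field_simp
  -- Positivity is used with s = √|m|, itself a function of the configuration, so that ⟨s²⟩ = ⟨|m|⟩.
  have t4 := two_mul_sum_sq_le (τ := τ) (y := fun x i => f (x i)) (s := fun x => √|m xs x|)
    (C := B + √C) (fun i => by fun_prop) (by fun_prop)
    (fun x i => (hB _).trans (le_add_of_nonneg_right (Real.sqrt_nonneg _))) fun x => by
      rw [abs_of_nonneg (Real.sqrt_nonneg _)]
      exact (Real.sqrt_le_sqrt (h.abs_m_le xs x)).trans (le_add_of_nonneg_left hB0)
  have t5 : (∫ x, √|m xs x| ^ 2 ∂τ) ^ 2 ≤ ∫ x, m xs x ^ 2 ∂τ := by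
    simp only [Real.sq_sqrt (abs_nonneg _)]
    have hv : 0 ≤ ∫ x, (|m xs x| - ∫ y, |m xs y| ∂τ) ^ 2 ∂τ := integral_nonneg fun x => sq_nonneg _
    set a := ∫ y, |m xs y| ∂τ with ha
    have : ∀ x, (|m xs x| - a) ^ 2 = m xs x ^ 2 - 2 * a * |m xs x| + a ^ 2 := fun x => by
      rw [sub_sq, sq_abs]; ring
    simp only [this] at hv
    have hi2 : Integrable (fun x => m xs x ^ 2 - 2 * a * |m xs x|) τ := hm2i.sub (hami.const_mul _)
    rw [integral_add hi2 (integrable_const _),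
      integral_sub hm2i (hami.const_mul _), integral_const_mul, ← ha] at hv
    simp at hv
    nlinarith
  have t6 : lam / 2 * ∑ i, (∫ x, √|m xs x| * f (x i) ∂τ) ^ 2 ≤
      lam / (4 * N) * (∑ i, ∑ j, (∫ x, f (x i) * f (x j) ∂τ) ^ 2) +
        lam * N / 4 * ∫ x, m xs x ^ 2 ∂τ := by
    have e : lam / 2 * ∑ i, (∫ x, √|m xs x| * f (x i) ∂τ) ^ 2 =
        lam / (4 * N) * (2 * N * ∑ i, (∫ x, √|m xs x| * f (x i) ∂τ) ^ 2) := by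
      field_simp; ring
    have e2 : lam * N / 4 * ∫ x, m xs x ^ 2 ∂τ =
        lam / (4 * N) * (N ^ 2 * ∫ x, m xs x ^ 2 ∂τ) := by
      field_simp
    rw [e, e2, ← mul_add]
    refine mul_le_mul_of_nonneg_left (t4.trans ?_) (by positivity)
    gcongr
  unfold overlapBracket
  linarith

theorem interpFree_le (h : ChannelBound m pen C) (hlam : 0 ≤ lam) (hf : Measurable f)
    (hB : ∀ x, |f x| ≤ B) (hN : 0 < N)
    (hm : ∀ xs x, |innerSum f xs x - N * m xs x| ≤ 1)
    (hpen : ∀ xs x, pen xs x = lam * N / 4 * m xs x ^ 2) :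
    interpFree P lam f m pen (Real.pi / 2) ≤
      interpFree P lam f m pen 0 + (lam * B ^ 4 / 4 + lam / 2) := by
  have hB0 := (abs_nonneg _).trans (hB 0)
  refine le_add_of_hasDerivAt_sin_cos (hasDerivAt_interpFree h hlam hf hB) fun s => ?_
  by_cases hi : Integrable (fun p => overlapBracket lam f m pen p.1 (interpGibbs P lam f m pen s p))
    ((Measure.pi fun _ => P).prod (gaussPi _))
  · refine (integral_mono hi (integrable_const (lam * B ^ 4 / 4 + lam / 2)) fun p => ?_).trans_eq
      (by simp)
    have := isProbabilityMeasure_interpGibbs (P := P) h hlam hf hB s p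
    exact overlapBracket_le h hlam hf hB hN hm hpen p.1 _
  -- A non-integrable bracket has integral 0 by convention, and the bound is nonnegative.
  · rw [integral_undef hi]
    positivity

end Derivative

/-! ### The lower bound: constant strength and the Nishimori identity -/

section LowerBound

variable {N : ℕ} {P : Measure ℝ} [IsProbabilityMeasure P] {lam : ℝ} {f : ℝ → ℝ} {B q : ℝ}

lemma channelBound_const (q : ℝ) :
    ChannelBound (N := N) (fun _ _ => q) (fun _ _ => 0) |q| :=
  ⟨measurable_const, measurable_const, fun _ _ => le_rfl, fun _ _ => by simp⟩

/-- The signal of the combined matrix and scalar channels. -/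
def channelSignal (lam : ℝ) (f : ℝ → ℝ) (q s : ℝ) (x : Fin N → ℝ) (a : UpperIndex N ⊕ Fin N) : ℝ :=
  amplitude s a * interpField lam f (fun _ _ => q) x x a

/-- The log-likelihood of an observation of the combined channels. -/
def channelLikelihood (lam : ℝ) (f : ℝ → ℝ) (q s : ℝ) (x : Fin N → ℝ)
    (g : UpperIndex N ⊕ Fin N → ℝ) : ℝ :=
  ∑ a, (channelSignal lam f q s x a * g a - channelSignal lam f q s x a ^ 2 / 2)

/-- For constant nonnegative strength, every interpolating Hamiltonian is the log-likelihood of a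
genuine observation. The drift weights match because cos² s + sin² s = 1; with q < 0 the signal part
of the scalar drift would have the wrong sign. -/
lemma interpEnergy_eq_likelihood (hlam : 0 ≤ lam) (hq : 0 ≤ q) (s : ℝ) (xs : Fin N → ℝ)
    (g : UpperIndex N ⊕ Fin N → ℝ) (x : Fin N → ℝ) :
    interpEnergy lam f (fun _ _ => q) (fun _ _ => 0) s xs g x =
      channelLikelihood lam f q s x (g + channelSignal lam f q s xs) := by
  have hp : pairDrift lam f xs x = ∑ p, (pairField lam f x p * pairField lam f xs p -
      pairField lam f x p ^ 2 / 2) := by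
    refine Finset.sum_congr rfl fun p _ => ?_
    unfold pairField
    split_ifs
    · have hr : √(lam / N) ^ 2 = lam / N := Real.sq_sqrt (by positivity)
      rw [show lam / (2 * (N : ℝ)) = lam / N / 2 by rw [div_div, mul_comm]]
      linear_combination -((f (x p.1.1) * f (x p.1.2)) * (f (xs p.1.1) * f (xs p.1.2)) -
        (f (x p.1.1) * f (x p.1.2)) ^ 2 / 2) * hr
    · simp
  have hw : scalarDrift lam f (fun _ _ => q) (fun _ _ => 0) xs x =
      ∑ i, ((√lam * (√|q| * f (x i))) * (√lam * (√|q| * f (xs i))) -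
        (√lam * (√|q| * f (x i))) ^ 2 / 2) := by
    rw [scalarDrift, innerSum, sub_zero, Finset.mul_sum, Finset.mul_sum, Finset.mul_sum,
      Finset.mul_sum, ← Finset.sum_sub_distrib]
    refine Finset.sum_congr rfl fun i _ => ?_
    rw [mul_mul_mul_comm, Real.mul_self_sqrt hlam, mul_mul_mul_comm (√|q|),
      Real.mul_self_sqrt (abs_nonneg q), mul_pow, mul_pow, Real.sq_sqrt hlam,
      Real.sq_sqrt (abs_nonneg q), abs_of_nonneg hq]
    ring
  rw [interpEnergy, fieldEnergy, channelLikelihood, hp, hw]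
  simp only [channelSignal, Fintype.sum_sum_type, interpField, amplitude, Sum.elim_inl,
    Sum.elim_inr, Pi.add_apply]
  have hs : Real.sin s ^ 2 = 1 - Real.cos s ^ 2 := Real.sin_sq s
  have e1 : ∀ p, Real.sin s * pairField lam f x p * (g (Sum.inl p) +
      Real.sin s * pairField lam f xs p) - (Real.sin s * pairField lam f x p) ^ 2 / 2 =
      Real.sin s * pairField lam f x p * g (Sum.inl p) + Real.sin s ^ 2 *
        (pairField lam f x p * pairField lam f xs p - pairField lam f x p ^ 2 / 2) :=
    fun p => by ring
  have e2 : ∀ i, Real.cos s * (√lam * (√|q| * f (x i))) * (g (Sum.inr i) +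
      Real.cos s * (√lam * (√|q| * f (xs i)))) -
        (Real.cos s * (√lam * (√|q| * f (x i)))) ^ 2 / 2 =
      Real.cos s * (√lam * (√|q| * f (x i))) * g (Sum.inr i) + Real.cos s ^ 2 *
        ((√lam * (√|q| * f (x i))) * (√lam * (√|q| * f (xs i))) -
        (√lam * (√|q| * f (x i))) ^ 2 / 2) := fun i => by ring
  simp only [e1, e2, Finset.sum_add_distrib, ← Finset.mul_sum]
  rw [hs]
  ring

lemma measurable_channelSignal (hf : Measurable f) (s : ℝ) (a : UpperIndex N ⊕ Fin N) :
    Measurable fun x => channelSignal lam f q s x a := by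
  unfold channelSignal
  refine Measurable.const_mul ?_ _
  cases a
  · exact measurable_pairField hf _
  · simp only [interpField, Sum.elim_inr]
    fun_prop

lemma measurable_channelLikelihood (hf : Measurable f) (s : ℝ) :
    Measurable fun p : (Fin N → ℝ) × (UpperIndex N ⊕ Fin N → ℝ) =>
      channelLikelihood lam f q s p.1 p.2 := by
  refine Finset.measurable_sum _ fun a _ => ?_
  have h1 : Measurable fun p : (Fin N → ℝ) × (UpperIndex N ⊕ Fin N → ℝ) =>
      channelSignal lam f q s p.1 a := (measurable_channelSignal hf s a).comp measurable_fst
  exact (h1.mul (by fun_prop)).sub ((h1.pow_const 2).div_const 2)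

lemma integrable_and_integral_nishimori (hlam : 0 ≤ lam) (hf : Measurable f)
    (hB : ∀ x, |f x| ≤ B) (hq : 0 ≤ q) (s : ℝ) {φ : (Fin N → ℝ) → ℝ} {K : ℝ}
    (hφ : Measurable φ) (hK : ∀ x, |φ x| ≤ K) :
    Integrable (fun p => φ p.1 * (∫ y, φ y ∂(interpGibbs P lam f (fun _ _ => q) (fun _ _ => 0) s p))
        - (∫ y, φ y ∂(interpGibbs P lam f (fun _ _ => q) (fun _ _ => 0) s p)) ^ 2)
      ((Measure.pi fun _ => P).prod (gaussPi _)) ∧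
    ∫ p, (φ p.1 * (∫ y, φ y ∂(interpGibbs P lam f (fun _ _ => q) (fun _ _ => 0) s p))
        - (∫ y, φ y ∂(interpGibbs P lam f (fun _ _ => q) (fun _ _ => 0) s p)) ^ 2)
      ∂((Measure.pi fun _ => P).prod (gaussPi _)) = 0 := by
  set μ : Measure (Fin N → ℝ) := Measure.pi fun _ => P
  obtain ⟨K', hK'⟩ := (channelBound_const (N := N) q).exists_fieldBound hlam hf hB
  have hkm : Measurable fun p => ∫ y, φ y
      ∂(interpGibbs P lam f (fun _ _ => q) (fun _ _ => 0) s p) :=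
    hK'.measurable_gibbs μ (f := fun _ y => φ y) (hφ.comp measurable_snd) (amplitude s)
      (Real.sin s ^ 2)
  have hkb : ∀ p, |∫ y, φ y ∂(interpGibbs P lam f (fun _ _ => q) (fun _ _ => 0) s p)| ≤ K :=
    fun p => hK'.abs_gibbs_le μ hK (abs_amplitude_le s) (abs_sin_sq_le s) p.1 p.2
  have hi1 : Integrable (fun p => φ p.1 *
      (∫ y, φ y ∂(interpGibbs P lam f (fun _ _ => q) (fun _ _ => 0) s p)))
      (μ.prod (gaussPi _)) :=
    integrable_of_abs_le (C := K * K) (by fun_prop) fun p => by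
      rw [abs_mul]
      exact mul_le_mul (hK _) (hkb p) (abs_nonneg _) ((abs_nonneg _).trans (hK p.1))
  have hi2 : Integrable (fun p =>
      (∫ y, φ y ∂(interpGibbs P lam f (fun _ _ => q) (fun _ _ => 0) s p)) ^ 2)
      (μ.prod (gaussPi _)) :=
    integrable_of_abs_le (C := K ^ 2) (hkm.pow_const 2) fun p => by
      rw [abs_pow]
      exact pow_le_pow_left₀ (abs_nonneg _) (hkb p) 2
  refine ⟨hi1.sub hi2, ?_⟩
  rw [integral_sub hi1 hi2, sub_eq_zero, integral_prod _ hi1, integral_prod _ hi2]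
  have hLm := measurable_channelLikelihood (N := N) (lam := lam) (q := q) hf s
  -- Any `g` is the observation produced by the signal 0 and the noise `g - channelSignal lam f q s
  -- 0`, so the bound on the energy transfers to the likelihood.
  have hLx : ∀ g, Integrable (fun x => Real.exp (channelLikelihood lam f q s x g)) μ := fun g => by
    have := integrable_exp_of_abs_le (ν := μ)
      (hK'.measurable_energy_right (amplitude s) (Real.sin s ^ 2) 0
        (g - channelSignal lam f q s 0))
      (hK'.abs_energy_le (abs_amplitude_le s) (abs_sin_sq_le s) 0 _)
    refine this.congr (.of_forall fun x => ?_)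
    have e := interpEnergy_eq_likelihood (f := f) hlam hq s 0 (g - channelSignal lam f q s 0) x
    rw [sub_add_cancel] at e
    simp only [← e, interpEnergy]
  have key := integral_mul_gibbs_eq_integral_sq (μ := μ) (γ := gaussPi (UpperIndex N ⊕ Fin N))
    (T := fun x g => g + channelSignal lam f q s x) (L := channelLikelihood lam f q s)
    (fun x => by fun_prop) hLm (fun x => gaussPi_map_add_eq_withDensity _) hLx hφ hK
  have hG : ∀ xs g, interpGibbs P lam f (fun _ _ => q) (fun _ _ => 0) s (xs, g) =
      μ.tilted fun y => channelLikelihood lam f q s y (g + channelSignal lam f q s xs) :=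
    fun xs g => by
      simp only [interpGibbs]
      congr 1
      ext x
      exact interpEnergy_eq_likelihood hlam hq s xs g x
  simp only [hG]
  exact key

/-- In mean, the Nishimori identity replaces the squared Gibbs averages by averages against the
signal. This halves the coefficients of R² and q R, and the result completes to a square around R =
Nq. The diagonal contributes at most lam B⁴/4. -/
theorem le_interpFree (hlam : 0 ≤ lam) (hf : Measurable f) (hB : ∀ x, |f x| ≤ B) (hN : 0 < N)
    (hq : 0 ≤ q) :
    interpFree (N := N) P lam f (fun _ _ => q) (fun _ _ => 0) 0 -
        (lam * N * q ^ 2 / 4 + lam * B ^ 4 / 4) ≤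
      interpFree (N := N) P lam f (fun _ _ => q) (fun _ _ => 0) (Real.pi / 2) := by
  have hc := channelBound_const (N := N) q
  have hN' : (0 : ℝ) < N := by exact_mod_cast hN
  have hB0 := (abs_nonneg _).trans (hB 0)
  suffices h : ∀ s, -(∫ p, overlapBracket (N := N) lam f (fun _ _ => q) (fun _ _ => 0) p.1
      (interpGibbs P lam f (fun _ _ => q) (fun _ _ => 0) s p)
      ∂((Measure.pi fun _ => P).prod (gaussPi _))) ≤ lam * N * q ^ 2 / 4 + lam * B ^ 4 / 4 by
    have := le_add_of_hasDerivAt_sin_cos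
      (F := fun s => -interpFree (N := N) P lam f (fun _ _ => q) (fun _ _ => 0) s)
      (fun s => ((hasDerivAt_interpFree hc hlam hf hB s).neg).congr_deriv (mul_neg _ _).symm) h
    linarith
  intro s
  set Q := (Measure.pi fun _ : Fin N => P).prod (gaussPi (UpperIndex N ⊕ Fin N)) with hQ
  set G := fun p => interpGibbs (N := N) P lam f (fun _ _ => q) (fun _ _ => 0) s p with hG
  have n2 : ∀ i j : Fin N, _ := fun i j => integrable_and_integral_nishimori (P := P) hlam hf hB hq s
    (φ := fun x => f (x i) * f (x j)) (K := B * B) (by fun_prop) fun x => by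
      rw [abs_mul]; exact mul_le_mul (hB _) (hB _) (abs_nonneg _) hB0
  have n1 : ∀ i : Fin N, _ := fun i => integrable_and_integral_nishimori (P := P) hlam hf hB hq s
    (φ := fun x => f (x i)) (K := B) (by fun_prop) fun x => hB _
  rw [← hQ] at n1 n2
  set D2 : Fin N → Fin N → _ → ℝ := fun i j p => f (p.1 i) * f (p.1 j) *
    (∫ y, f (y i) * f (y j) ∂(G p)) - (∫ y, f (y i) * f (y j) ∂(G p)) ^ 2 with hD2
  set D1 : Fin N → _ → ℝ := fun i p => f (p.1 i) * (∫ y, f (y i) ∂(G p)) -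
    (∫ y, f (y i) ∂(G p)) ^ 2 with hD1
  -- `rest` collects the Nishimori differences with the coefficients occurring in the bracket. It
  -- has mean zero, so the bracket may be compared with it pointwise.
  set rest : _ → ℝ := fun p => lam / (4 * N) * (∑ i, ∑ j, D2 i j p) -
    lam / (4 * N) * (∑ i, D2 i i p) - lam * q / 2 * ∑ i, D1 i p with hrest
  have hri : Integrable rest Q := by
    refine ((Integrable.const_mul ?_ _).sub (Integrable.const_mul ?_ _)).sub
      (Integrable.const_mul ?_ _)
    · exact integrable_finsetSum _ fun i _ => integrable_finsetSum _ fun j _ => (n2 i j).1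
    · exact integrable_finsetSum _ fun i _ => (n2 i i).1
    · exact integrable_finsetSum _ fun i _ => (n1 i).1
  have hr0 : ∫ p, rest p ∂Q = 0 := by
    have i1 : Integrable (fun p => lam / (4 * N) * (∑ i, ∑ j, D2 i j p)) Q :=
      (integrable_finsetSum _ fun i _ => integrable_finsetSum _ fun j _ => (n2 i j).1).const_mul _
    have i2 : Integrable (fun p => lam / (4 * N) * (∑ i, D2 i i p)) Q :=
      (integrable_finsetSum _ fun i _ => (n2 i i).1).const_mul _
    have i3 : Integrable (fun p => lam * q / 2 * ∑ i, D1 i p) Q :=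
      (integrable_finsetSum _ fun i _ => (n1 i).1).const_mul _
    have i12 : Integrable (fun p => lam / (4 * N) * (∑ i, ∑ j, D2 i j p) -
      lam / (4 * N) * (∑ i, D2 i i p)) Q := i1.sub i2
    simp only [hrest]
    rw [integral_sub i12 i3, integral_sub i1 i2, integral_const_mul, integral_const_mul,
      integral_const_mul, integral_finsetSum _ fun i _ => integrable_finsetSum _
        fun j _ => (n2 i j).1, integral_finsetSum _ fun i _ => (n2 i i).1,
      integral_finsetSum _ fun i _ => (n1 i).1]
    have z2 : ∀ i j, ∫ p, D2 i j p ∂Q = 0 := fun i j => (n2 i j).2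
    have z1 : ∀ i, ∫ p, D1 i p ∂Q = 0 := fun i => (n1 i).2
    have z2' : ∀ i, ∫ p, ∑ j, D2 i j p ∂Q = 0 := fun i =>
      (integral_finsetSum _ fun j _ => (n2 i j).1).trans (Finset.sum_eq_zero fun j _ => z2 i j)
    rw [Finset.sum_eq_zero fun i _ => z2' i, Finset.sum_eq_zero fun i _ => z2 i i,
      Finset.sum_eq_zero fun i _ => z1 i]
    ring
  have hpt : ∀ p, rest p - (lam * N * q ^ 2 / 4 + lam * B ^ 4 / 4) ≤
      overlapBracket lam f (fun _ _ => q) (fun _ _ => 0) p.1 (G p) := fun p => by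
    have hprob : IsProbabilityMeasure (G p) :=
      isProbabilityMeasure_interpGibbs (P := P) hc hlam hf hB s p
    have hfi : ∀ i, Integrable (fun x : Fin N → ℝ => f (x i)) (G p) := fun i =>
      integrable_of_abs_le (by fun_prop) fun x => hB _
    have hffi : ∀ i j, Integrable (fun x : Fin N → ℝ => f (x i) * f (x j)) (G p) := fun i j =>
      integrable_of_abs_le (C := B * B) (by fun_prop) fun x => by
        rw [abs_mul]; exact mul_le_mul (hB _) (hB _) (abs_nonneg _) hB0
    have hin : Measurable (innerSum f p.1) := (measurable_innerSum hf).comp measurable_prodMk_left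
    have hini : Integrable (innerSum f p.1) (G p) := integrable_of_abs_le hin (abs_innerSum_le hB _)
    have hin2i : Integrable (fun x => innerSum f p.1 x ^ 2) (G p) :=
      integrable_of_abs_le (C := (N * B ^ 2) ^ 2) (hin.pow_const 2) fun x => by
        rw [abs_pow]; exact pow_le_pow_left₀ (abs_nonneg _) (abs_innerSum_le hB _ _) 2
    have a1 : ∫ x, innerSum f p.1 x ∂(G p) = ∑ i, f (p.1 i) * ∫ x, f (x i) ∂(G p) := by
      simp only [innerSum]
      rw [integral_finsetSum _ fun i _ => (hfi i).mul_const _]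
      exact Finset.sum_congr rfl fun i _ => by rw [integral_mul_const, mul_comm]
    have a2 : ∫ x, innerSum f p.1 x ^ 2 ∂(G p) =
        ∑ i, ∑ j, f (p.1 i) * f (p.1 j) * ∫ x, f (x i) * f (x j) ∂(G p) := by
      have : ∀ x, innerSum f p.1 x ^ 2 =
          ∑ i, ∑ j, f (p.1 i) * f (p.1 j) * (f (x i) * f (x j)) := fun x => by
        rw [innerSum, pow_two, Finset.sum_mul_sum]
        exact Finset.sum_congr rfl fun i _ => Finset.sum_congr rfl fun j _ => by ring
      simp only [this]
      rw [integral_finsetSum _ fun i _ => integrable_finsetSum _ fun j _ => (hffi i j).const_mul _]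
      refine Finset.sum_congr rfl fun i _ => ?_
      rw [integral_finsetSum _ fun j _ => (hffi i j).const_mul _]
      exact Finset.sum_congr rfl fun j _ => by rw [integral_const_mul]
    have a3 : ∀ i, ∫ x, (f (x i) * f (p.1 i)) ^ 2 ∂(G p) =
        f (p.1 i) * f (p.1 i) * ∫ x, f (x i) * f (x i) ∂(G p) := fun i => by
      rw [← integral_const_mul]
      exact integral_congr_ae (.of_forall fun x => by ring)
    have a4 : ∀ i, (∫ x, √|q| * f (x i) ∂(G p)) ^ 2 = q * (∫ x, f (x i) ∂(G p)) ^ 2 := fun i => by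
      rw [integral_const_mul, mul_pow, Real.sq_sqrt (abs_nonneg _), abs_of_nonneg hq]
    have a5 : ∫ x, (lam / (2 * N) * innerSum f p.1 x ^ 2 - lam * (q * innerSum f p.1 x) + 0) ∂(G p)
        = lam / (2 * N) * (∫ x, innerSum f p.1 x ^ 2 ∂(G p)) -
          lam * (q * ∫ x, innerSum f p.1 x ∂(G p)) := by
      simp only [add_zero]
      rw [integral_sub (hin2i.const_mul _) ((hini.const_mul _).const_mul _), integral_const_mul,
        integral_const_mul, integral_const_mul]
    -- Completing the square: lam/(4N) · (R - Nq)² ≥ 0, averaged over the Gibbs measure.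
    have a6 : -(lam * N * q ^ 2 / 4) ≤ lam / (4 * N) * (∫ x, innerSum f p.1 x ^ 2 ∂(G p)) -
        lam * q / 2 * ∫ x, innerSum f p.1 x ∂(G p) := by
      rw [← integral_const_mul, ← integral_const_mul, ← integral_sub (hin2i.const_mul _)
        (hini.const_mul _)]
      have : ∫ _x, -(lam * N * q ^ 2 / 4) ∂(G p) = -(lam * N * q ^ 2 / 4) := by simp
      rw [← this]
      refine integral_mono (integrable_const _) ((hin2i.const_mul _).sub (hini.const_mul _))
        fun x => ?_
      have h1 : 0 ≤ lam / (4 * N) * (innerSum f p.1 x - N * q) ^ 2 := by positivity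
      have h2 : lam / (4 * N) * (innerSum f p.1 x - N * q) ^ 2 = lam / (4 * N) *
          innerSum f p.1 x ^ 2 - lam * q / 2 * innerSum f p.1 x + lam * N * q ^ 2 / 4 := by
        field_simp; ring
      simp only
      linarith
    have a7 : lam / (4 * N) * ∑ i, f (p.1 i) * f (p.1 i) * ∫ x, f (x i) * f (x i) ∂(G p) ≤
        lam * B ^ 4 / 4 := by
      have : ∑ i, f (p.1 i) * f (p.1 i) * ∫ x, f (x i) * f (x i) ∂(G p) ≤ N * B ^ 4 := by
        refine (Finset.sum_le_card_nsmul _ _ (B ^ 4) fun i _ => ?_).trans_eq (by simp)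
        have hb : |∫ x, f (x i) * f (x i) ∂(G p)| ≤ B * B := by
          simpa using norm_integral_le_of_norm_le_const (μ := G p) (f := fun x => f (x i) * f (x i))
            (C := B * B) (.of_forall fun x => by
              rw [Real.norm_eq_abs, abs_mul]
              exact mul_le_mul (hB _) (hB _) (abs_nonneg _) hB0)
        have hb2 : |f (p.1 i) * f (p.1 i)| ≤ B * B := by
          rw [abs_mul]; exact mul_le_mul (hB _) (hB _) (abs_nonneg _) hB0
        calc _ ≤ |f (p.1 i) * f (p.1 i) * ∫ x, f (x i) * f (x i) ∂(G p)| := le_abs_self _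
          _ ≤ (B * B) * (B * B) := by
            rw [abs_mul]; exact mul_le_mul hb2 hb (abs_nonneg _) (by positivity)
          _ = B ^ 4 := by ring
      calc _ ≤ lam / (4 * N) * (N * B ^ 4) := by gcongr
        _ = lam * B ^ 4 / 4 := by field_simp
    have a8 : lam / (2 * (N : ℝ)) = 2 * (lam / (4 * N)) := by field_simp; ring
    simp only [overlapBracket, hrest, hD2, hD1, Finset.sum_sub_distrib, a3, a4, a5, pow_two (f _),
      ← Finset.mul_sum]
    rw [a1, a2] at a6
    rw [a8, a1]
    rw [a2]
    linarith
  by_cases hi : Integrable (fun p =>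
      overlapBracket lam f (fun _ _ => q) (fun _ _ => 0) p.1 (G p)) Q
  · have := integral_mono (hri.sub (integrable_const (lam * N * q ^ 2 / 4 + lam * B ^ 4 / 4))) hi hpt
    simp only [Pi.sub_apply] at this
    rw [integral_sub hri (integrable_const _), hr0] at this
    simp at this
    simp only [hG] at this ⊢
    linarith
  -- In the non-integrable case the integral is 0 by convention, and the bound is nonnegative.
  · rw [integral_undef hi]
    simp only [neg_zero]
    positivity

end LowerBound

/-! ### Endpoints of the interpolation -/

section Endpoints

lemma measurePreserving_comp_inl {ι κ : Type*} [Fintype ι] [Fintype κ] :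
    MeasurePreserving (fun g : ι ⊕ κ → ℝ => fun a => g (Sum.inl a)) (gaussPi (ι ⊕ κ)) (gaussPi ι) :=
  measurePreserving_fst.comp (measurePreserving_sumPiEquivProdPi fun _ : ι ⊕ κ => gaussianReal 0 1)

/-- Noise of the prescribed variances obtained by scaling standard Gaussian variables. -/
def scaledNoise (σ : ℝ≥0) {N : ℕ} (g : UpperIndex N → ℝ) (p : UpperIndex N) : ℝ :=
  (if p.1.1 = p.1.2 then (σ : ℝ) else 1) * g p

lemma measurePreserving_scaledNoise (σ : ℝ≥0) (N : ℕ) :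
    MeasurePreserving (scaledNoise σ (N := N)) (gaussPi _) (noiseLaw σ N) := by
  have h : ∀ p : UpperIndex N, (gaussianReal 0 1).map
      (fun z => (if p.1.1 = p.1.2 then (σ : ℝ) else 1) * z) =
      gaussianReal 0 (if p.1.1 = p.1.2 then σ ^ 2 else 1) := fun p => by
    rw [gaussianReal_map_const_mul]
    congr 1
    · simp
    · ext
      split_ifs <;> simp
  have : ∀ p : UpperIndex N, SigmaFinite ((gaussianReal 0 1).map
      (fun z => (if p.1.1 = p.1.2 then (σ : ℝ) else 1) * z)) := fun p => by
    rw [h p]; infer_instance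
  refine ⟨by unfold scaledNoise; fun_prop, ?_⟩
  have := Measure.pi_map_pi (μ := fun _ : UpperIndex N => gaussianReal 0 1)
    (f := fun p z => (if p.1.1 = p.1.2 then (σ : ℝ) else 1) * z) (fun p => by fun_prop)
  simp only [h] at this
  exact this

variable {N : ℕ} {P : Measure ℝ} [IsProbabilityMeasure P] {lam : ℝ} {f : ℝ → ℝ} {B C : ℝ}
  {m pen : (Fin N → ℝ) → (Fin N → ℝ) → ℝ}

/-- Only strictly upper triangular entries enter the Hamiltonian, so the diagonal scale `σ`
disappears. This is why the final constants do not depend on it. -/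
lemma negHamiltonian_observation (hlam : 0 ≤ lam) (σ : ℝ≥0) (xs x : Fin N → ℝ)
    (g : UpperIndex N → ℝ) (hxs : ∀ i, f (xs i) = xs i) (hx : ∀ i, f (x i) = x i) :
    negHamiltonian lam (observation lam xs (scaledNoise σ g)) x =
      ∑ p, pairField lam f x p * g p + pairDrift lam f xs x := by
  rw [negHamiltonian, ← sum_upperIndex, pairDrift, ← Finset.sum_add_distrib]
  refine Finset.sum_congr rfl fun p _ => ?_
  simp only [pairField]
  split_ifs with hp
  · have hr : √(lam / N) ^ 2 = lam / N := Real.sq_sqrt (by positivity)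
    have e : scaledNoise σ g ⟨(min p.1.1 p.1.2, max p.1.1 p.1.2), min_le_max⟩ = g p := by
      have : (⟨(min p.1.1 p.1.2, max p.1.1 p.1.2), min_le_max⟩ : UpperIndex N) = p := by
        ext1
        simp [min_eq_left hp.le, max_eq_right hp.le]
      rw [this, scaledNoise, if_neg hp.ne, one_mul]
    simp only [observation, symmMatrix, Matrix.add_apply, Matrix.smul_apply, Matrix.vecMulVec_apply,
      Matrix.of_apply, e, smul_eq_mul, hx, hxs]
    linear_combination (xs p.1.1 * xs p.1.2 * x p.1.1 * x p.1.2) * hr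
  · simp

lemma measurable_logPartition (lam : ℝ) (N : ℕ) :
    Measurable (logPartition P lam (N := N)) := by
  refine Real.measurable_log.comp (measurable_integral_param
    (f := fun (ω : (Fin N → ℝ) × (UpperIndex N → ℝ)) x =>
      Real.exp (negHamiltonian lam (observation lam ω.1 ω.2) x)) (Real.measurable_exp.comp ?_))
  unfold negHamiltonian observation symmMatrix
  simp only [Matrix.add_apply, Matrix.smul_apply, Matrix.vecMulVec_apply, Matrix.of_apply]
  fun_prop

lemma ae_pi_forall {p : ℝ → Prop} (h : ∀ᵐ x ∂P, p x) :
    ∀ᵐ x ∂(Measure.pi fun _ : Fin N => P), ∀ i, p (x i) :=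
  ae_all_iff.2 fun i => (measurePreserving_eval (fun _ : Fin N => P) i).quasiMeasurePreserving.ae h

lemma interpEnergy_pi_div_two (xs x : Fin N → ℝ) (g : UpperIndex N ⊕ Fin N → ℝ) :
    interpEnergy lam f m pen (Real.pi / 2) xs g x =
      ∑ p, pairField lam f x p * g (Sum.inl p) + pairDrift lam f xs x := by
  simp [interpEnergy, fieldEnergy, amplitude, interpField]

lemma interpEnergy_zero (xs x : Fin N → ℝ) (g : UpperIndex N ⊕ Fin N → ℝ) :
    interpEnergy lam f m pen 0 xs g x =
      ∑ i, √lam * (√|m xs x| * f (x i)) * g (Sum.inr i) + scalarDrift lam f m pen xs x := by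
  simp [interpEnergy, fieldEnergy, amplitude, interpField]

lemma integrable_interp (h : ChannelBound m pen C) (hlam : 0 ≤ lam) (hf : Measurable f)
    (hB : ∀ x, |f x| ≤ B) (s : ℝ) :
    Integrable (fun p : (Fin N → ℝ) × (UpperIndex N ⊕ Fin N → ℝ) =>
      Real.log (∫ x, Real.exp (interpEnergy lam f m pen s p.1 p.2 x) ∂(Measure.pi fun _ => P)))
      ((Measure.pi fun _ => P).prod (gaussPi _)) := by
  obtain ⟨K, hK⟩ := h.exists_fieldBound hlam hf hB
  exact hK.integrable_logPartition _ _ (abs_amplitude_le s) (abs_sin_sq_le s)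

/-- At s = π/2 the scalar channels are switched off, so every choice of `m` and `pen` leads to the
same matrix model. Both bounds use this endpoint. -/
lemma integrable_and_integral_logPartition (h : ChannelBound m pen C) (hlam : 0 ≤ lam)
    (hf : Measurable f) (hB : ∀ x, |f x| ≤ B) (hfP : ∀ᵐ x ∂P, f x = x) (σ : ℝ≥0) :
    Integrable (logPartition P lam) (jointLaw P σ N) ∧
      ∫ ω, logPartition P lam ω ∂(jointLaw P σ N) = interpFree P lam f m pen (Real.pi / 2) := by
  have hmp : MeasurePreserving (fun p : (Fin N → ℝ) × (UpperIndex N ⊕ Fin N → ℝ) =>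
      (p.1, scaledNoise σ fun a => p.2 (Sum.inl a)))
      ((Measure.pi fun _ => P).prod (gaussPi _)) (jointLaw P σ N) :=
    (MeasurePreserving.id _).prod
      ((measurePreserving_scaledNoise σ N).comp measurePreserving_comp_inl)
  have hm := measurable_logPartition (P := P) lam N
  have hae : (fun p : (Fin N → ℝ) × (UpperIndex N ⊕ Fin N → ℝ) =>
      logPartition P lam (p.1, scaledNoise σ fun a => p.2 (Sum.inl a))) =ᵐ[
      (Measure.pi fun _ => P).prod (gaussPi _)] fun p =>
      Real.log (∫ x, Real.exp (interpEnergy lam f m pen (Real.pi / 2) p.1 p.2 x)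
        ∂(Measure.pi fun _ => P)) := by
    have h1 := Measure.quasiMeasurePreserving_fst
      (μ := Measure.pi fun _ : Fin N => P) (ν := gaussPi (UpperIndex N ⊕ Fin N))
      |>.ae (ae_pi_forall hfP)
    filter_upwards [h1] with p hp
    simp only [logPartition, partitionFunction]
    congr 1
    refine integral_congr_ae ?_
    filter_upwards [ae_pi_forall hfP] with x hx
    rw [negHamiltonian_observation hlam σ p.1 x _ hp hx, interpEnergy_pi_div_two]
  constructor
  · exact (hmp.integrable_comp hm.aestronglyMeasurable).1
      ((integrable_interp h hlam hf hB _).congr hae.symm)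
  · rw [← hmp.map_eq, integral_map hmp.measurable.aemeasurable hm.aestronglyMeasurable]
    exact integral_congr_ae hae

end Endpoints

/-! ### The scalar channel -/

section Scalar

variable (P : Measure ℝ) (lam : ℝ) (f : ℝ → ℝ) (m : ℝ)

/-- The exponent of a scalar channel of signed strength `m`. -/
def channelExponent (ω : ℝ × ℝ) (x : ℝ) : ℝ :=
  √lam * (√|m| * f x) * ω.2 + lam * (m * (f x * f ω.1)) - lam / 2 * (|m| * f x ^ 2)

/-- The log-partition function of a scalar channel of signed strength `m`. -/
def channelLog (ω : ℝ × ℝ) : ℝ :=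
  Real.log (∫ x, Real.exp (channelExponent lam f m ω x) ∂P)

variable {P lam f m} [IsProbabilityMeasure P] {B D : ℝ}

lemma measurable_channelExponent (hf : Measurable f) :
    Measurable fun p : (ℝ × ℝ) × ℝ => channelExponent lam f m p.1 p.2 := by
  unfold channelExponent
  fun_prop

lemma measurable_channelLog (hf : Measurable f) : Measurable (channelLog P lam f m) :=
  Real.measurable_log.comp (measurable_integral_param
    (Real.measurable_exp.comp (measurable_channelExponent hf)))

lemma abs_channelExponent_le (hlam : 0 ≤ lam) (hB : ∀ x, |f x| ≤ B) (hm : |m| ≤ D) (ω : ℝ × ℝ)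
    (x : ℝ) : |channelExponent lam f m ω x| ≤
      (√lam * (√D * B) + lam * (D * (B * B)) + lam / 2 * (D * B ^ 2)) * (1 + |ω.2|) := by
  have hB0 := (abs_nonneg _).trans (hB 0)
  have hD0 := (abs_nonneg _).trans hm
  have h1 : |√lam * (√|m| * f x) * ω.2| ≤ √lam * (√D * B) * |ω.2| := by
    rw [abs_mul, abs_mul, abs_mul, abs_of_nonneg (Real.sqrt_nonneg _),
      abs_of_nonneg (Real.sqrt_nonneg _)]
    gcongr
    exact hB x
  have h2 : |lam * (m * (f x * f ω.1))| ≤ lam * (D * (B * B)) := by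
    rw [abs_mul, abs_mul, abs_mul, abs_of_nonneg hlam]
    gcongr <;> exact hB _
  have h3 : |lam / 2 * (|m| * f x ^ 2)| ≤ lam / 2 * (D * B ^ 2) := by
    rw [abs_mul, abs_mul, abs_abs, abs_pow, abs_of_nonneg (show 0 ≤ lam / 2 by positivity)]
    gcongr
    exact hB x
  have h4 : 0 ≤ (lam * (D * (B * B)) + lam / 2 * (D * B ^ 2)) * |ω.2| := by positivity
  have h5 : 0 ≤ √lam * (√D * B) := by positivity
  unfold channelExponent
  refine (abs_sub _ _).trans ?_
  have := abs_add_le (√lam * (√|m| * f x) * ω.2) (lam * (m * (f x * f ω.1)))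
  nlinarith

lemma abs_channelLog_le (hlam : 0 ≤ lam) (hf : Measurable f) (hB : ∀ x, |f x| ≤ B)
    (hm : |m| ≤ D) (ω : ℝ × ℝ) : |channelLog P lam f m ω| ≤
      (√lam * (√D * B) + lam * (D * (B * B)) + lam / 2 * (D * B ^ 2)) * (1 + |ω.2|) :=
  abs_log_integral_exp_le ((measurable_channelExponent hf).comp measurable_prodMk_left)
    (abs_channelExponent_le hlam hB hm ω)

lemma integrable_one_add_abs_snd (A : ℝ) :
    Integrable (fun ω : ℝ × ℝ => A * (1 + |ω.2|)) (P.prod (gaussianReal 0 1)) :=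
  ((integrable_const _).add (integrable_abs_gaussian.comp_snd P)).const_mul A

lemma integrable_channelLog (hlam : 0 ≤ lam) (hf : Measurable f) (hB : ∀ x, |f x| ≤ B) :
    Integrable (channelLog P lam f m) (P.prod (gaussianReal 0 1)) :=
  (integrable_one_add_abs_snd _).mono' (measurable_channelLog hf).aestronglyMeasurable
    (.of_forall (abs_channelLog_le hlam hf hB le_rfl))

omit [IsProbabilityMeasure P] in
lemma scalarLogPartition_ae_eq (hlam : 0 ≤ lam) (hfP : ∀ᵐ x ∂P, f x = x) (hm : 0 ≤ m) :
    scalarLogPartition P (lam * m) =ᵐ[P.prod (gaussianReal 0 1)] channelLog P lam f m := by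
  have h1 := Measure.quasiMeasurePreserving_fst (μ := P) (ν := gaussianReal 0 1) |>.ae hfP
  filter_upwards [h1] with ω hω
  simp only [scalarLogPartition, channelLog]
  congr 1
  refine integral_congr_ae ?_
  filter_upwards [hfP] with x hx
  simp only [scalarWeight, channelExponent, hω, hx]
  rw [Real.sqrt_mul hlam, abs_of_nonneg hm]
  congr 1
  ring

omit [IsProbabilityMeasure P] in
lemma psi_eq (hlam : 0 ≤ lam) (hfP : ∀ᵐ x ∂P, f x = x) (hm : 0 ≤ m) :
    psi P (lam * m) = ∫ ω, channelLog P lam f m ω ∂(P.prod (gaussianReal 0 1)) :=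
  integral_congr_ae (scalarLogPartition_ae_eq hlam hfP hm)

/-- With constant strength and no penalty, the energy at s = 0 is a sum over sites, so the partition
function factorizes. -/
lemma integral_interp_zero {N : ℕ} (hlam : 0 ≤ lam) (hf : Measurable f) (hB : ∀ x, |f x| ≤ B) :
    interpFree (N := N) P lam f (fun _ _ => m) (fun _ _ => 0) 0 =
      N * ∫ ω, channelLog P lam f m ω ∂(P.prod (gaussianReal 0 1)) := by
  have hmp : ∀ i : Fin N, MeasurePreserving
      (fun p : (Fin N → ℝ) × (UpperIndex N ⊕ Fin N → ℝ) => (p.1 i, p.2 (Sum.inr i)))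
      ((Measure.pi fun _ => P).prod (gaussPi _)) (P.prod (gaussianReal 0 1)) := fun i =>
    (measurePreserving_eval (fun _ : Fin N => P) i).prod
      (measurePreserving_eval (fun _ : UpperIndex N ⊕ Fin N => gaussianReal 0 1) (Sum.inr i))
  have hi := integrable_channelLog (P := P) (m := m) hlam hf hB
  have e : ∀ p : (Fin N → ℝ) × (UpperIndex N ⊕ Fin N → ℝ),
      Real.log (∫ x, Real.exp (interpEnergy lam f (fun _ _ => m) (fun _ _ => 0) 0 p.1 p.2 x)
        ∂(Measure.pi fun _ => P)) = ∑ i, channelLog P lam f m (p.1 i, p.2 (Sum.inr i)) := fun p => by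
    have h1 : ∀ x : Fin N → ℝ,
        Real.exp (interpEnergy lam f (fun _ _ => m) (fun _ _ => 0) 0 p.1 p.2 x) =
        ∏ i, Real.exp (channelExponent lam f m (p.1 i, p.2 (Sum.inr i)) (x i)) := fun x => by
      rw [← Real.exp_sum, interpEnergy_zero, scalarDrift, innerSum]
      congr 1
      simp only [channelExponent, Finset.sum_add_distrib, Finset.sum_sub_distrib, Finset.mul_sum]
      ring
    simp only [h1]
    rw [integral_fintype_prod_eq_prod (fun i y =>
      Real.exp (channelExponent lam f m (p.1 i, p.2 (Sum.inr i)) y)), Real.log_prod]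
    · rfl
    · intro i _
      exact (integral_exp_pos_of_abs_le ((measurable_channelExponent hf).comp
        measurable_prodMk_left) (abs_channelExponent_le hlam hB le_rfl _)).ne'
  unfold interpFree
  simp only [e]
  have hi' : ∀ i : Fin N, Integrable (fun p : (Fin N → ℝ) × (UpperIndex N ⊕ Fin N → ℝ) =>
      channelLog P lam f m (p.1 i, p.2 (Sum.inr i))) ((Measure.pi fun _ => P).prod (gaussPi _)) :=
    fun i => (hmp i).integrable_comp_of_integrable hi
  rw [integral_finsetSum _ fun i _ => hi' i]
  have : ∀ i : Fin N, ∫ p, channelLog P lam f m (p.1 i, p.2 (Sum.inr i))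
      ∂((Measure.pi fun _ => P).prod (gaussPi (UpperIndex N ⊕ Fin N))) =
      ∫ ω, channelLog P lam f m ω ∂(P.prod (gaussianReal 0 1)) := fun i => by
    rw [← (hmp i).map_eq, integral_map (hmp i).measurable.aemeasurable
      (measurable_channelLog hf).aestronglyMeasurable]
  simp [this]

end Scalar

/-! ### Channels of negative strength -/

section Sign

variable {P : Measure ℝ} [IsProbabilityMeasure P] {U : ℝ → ℝ} {c : ℝ}

lemma abs_likelihood_le (hc : ∀ x, |U x| ≤ c) (x y : ℝ) :
    |U x * y - U x ^ 2 / 2| ≤ (c + c ^ 2 / 2) * (1 + |y|) := by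
  have hc0 := (abs_nonneg _).trans (hc 0)
  have h1 : |U x * y| ≤ c * |y| := by
    rw [abs_mul]; exact mul_le_mul_of_nonneg_right (hc x) (abs_nonneg _)
  have h2 : |U x ^ 2 / 2| ≤ c ^ 2 / 2 := by
    rw [abs_div, abs_pow, abs_two]
    have := pow_le_pow_left₀ (abs_nonneg _) (hc x) 2
    linarith
  have h3 : 0 ≤ c ^ 2 / 2 * |y| := by positivity
  have := abs_sub (U x * y) (U x ^ 2 / 2)
  linarith

lemma integrable_exp_one_add_abs (t : ℝ) :
    Integrable (fun z : ℝ => Real.exp (t * (1 + |z|))) (gaussianReal 0 1) := by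
  simp only [mul_add, Real.exp_add]
  exact (integrable_exp_abs_gaussian t).const_mul _

/-- Reversing the sign of the signal decreases the expected log-likelihood ratio. -/
lemma integral_log_reflect_le (hU : Measurable U) (hc : ∀ x, |U x| ≤ c) :
    ∫ xs, ∫ z, Real.log (∫ x, Real.exp (U x * (z - U xs) - U x ^ 2 / 2) ∂P)
      ∂(gaussianReal 0 1) ∂P ≤
    ∫ xs, ∫ z, Real.log (∫ x, Real.exp (U x * (z + U xs) - U x ^ 2 / 2) ∂P)
      ∂(gaussianReal 0 1) ∂P := by
  set A := c + c ^ 2 / 2 with hA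
  set γ := gaussianReal 0 1 with hγ
  set W : ℝ → ℝ := fun y => ∫ x, Real.exp (U x * y - U x ^ 2 / 2) ∂P with hW
  set h : ℝ → ℝ := fun y => Real.log (W y) with hh
  have hLm : Measurable fun p : ℝ × ℝ => U p.1 * p.2 - U p.1 ^ 2 / 2 := by fun_prop
  have hWm : Measurable W := measurable_integral_param
    (f := fun y x => Real.exp (U x * y - U x ^ 2 / 2))
    (Real.measurable_exp.comp (hLm.comp measurable_swap))
  have hhm : Measurable h := Real.measurable_log.comp hWm
  have hLx : ∀ y, Measurable fun x => U x * y - U x ^ 2 / 2 := fun y => by fun_prop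
  have hWpos : ∀ y, 0 < W y := fun y =>
    integral_exp_pos_of_abs_le (hLx y) fun x => abs_likelihood_le hc x y
  have hhb : ∀ y, |h y| ≤ A * (1 + |y|) := fun y =>
    abs_log_integral_exp_le (hLx y) fun x => abs_likelihood_le hc x y
  have hbd : ∀ (y u l : ℝ), |u| ≤ A * (1 + |y|) → l ≤ A * (1 + |y|) →
      |u * Real.exp l| ≤ Real.exp (2 * A * (1 + |y|)) := fun y u l hu hl => by
    rw [abs_mul, Real.abs_exp, show 2 * A * (1 + |y|) = A * (1 + |y|) + A * (1 + |y|) by ring,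
      Real.exp_add]
    have h1 : A * (1 + |y|) ≤ Real.exp (A * (1 + |y|)) := by
      linarith [Real.add_one_le_exp (A * (1 + |y|))]
    exact mul_le_mul (hu.trans h1) (Real.exp_le_exp.2 hl) (Real.exp_pos _).le (Real.exp_pos _).le
  -- The observation `z + U xs` has density `W` with respect to the standard Gaussian.
  have hprod : ∀ k : ℝ → ℝ, Measurable k → (∀ y, |k y| ≤ A * (1 + |y|)) →
      ∫ xs, ∫ z, k (z + U xs) ∂γ ∂P = ∫ z, k z * W z ∂γ := fun k hk hkb => by
    have := integral_planted (μ := P) (γ := γ) (T := fun x z => z + U x)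
      (L := fun x z => U x * z - U x ^ 2 / 2) (fun x => by fun_prop) hLm
      (fun x => gaussianReal_map_add_eq_withDensity (U x)) (F := fun _ z => k z) (by fun_prop)
      (((integrable_exp_one_add_abs (2 * A)).comp_snd P).mono' (by fun_prop)
        (.of_forall fun p => hbd p.2 _ _ (hkb p.2)
          ((le_abs_self _).trans (abs_likelihood_le hc _ _))))
    rw [this]
    simp only [integral_const_mul, hW]
  have hsymm : ∀ k : ℝ → ℝ, Measurable k → ∫ z, k (-z) ∂γ = ∫ z, k z ∂γ := fun k hk => by
    have e := gaussianReal_map_neg (μ := 0) (v := 1)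
    rw [neg_zero] at e
    conv_rhs => rw [hγ, ← e]
    rw [integral_map (by fun_prop) hk.aestronglyMeasurable]
  have hint : ∀ k : ℝ → ℝ, Measurable k → (∀ y, |k y| ≤ A * (1 + |y|)) →
      Integrable (fun z => k z * W z) γ := fun k hk hkb => by
    refine (integrable_exp_one_add_abs (2 * A)).mono' (by fun_prop) (.of_forall fun z => ?_)
    rw [← Real.exp_log (hWpos z)]
    exact hbd z _ _ (hkb z) ((le_abs_self _).trans (hhb z))
  have hhb' : ∀ y, |h (-y)| ≤ A * (1 + |y|) := fun y => by simpa using hhb (-y)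
  have hhm' : Measurable fun y => h (-y) := by fun_prop
  have eplus : ∫ xs, ∫ z, h (z + U xs) ∂γ ∂P = ∫ z, h z * W z ∂γ := hprod h hhm hhb
  -- By symmetry of the noise, `z - U xs` is distributed as minus the observation.
  have eminus : ∫ xs, ∫ z, h (z - U xs) ∂γ ∂P = ∫ z, h (-z) * W z ∂γ := by
    rw [← hprod (fun y => h (-y)) hhm' hhb']
    refine integral_congr_ae (.of_forall fun xs => ?_)
    simp only
    rw [← hsymm (fun z => h (z - U xs)) (by fun_prop)]
    refine integral_congr_ae (.of_forall fun z => ?_)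
    simp only
    congr 1
    ring
  have i1 := hint h hhm hhb
  have i2 := hint _ hhm' hhb'
  have i3 : Integrable (fun z => (h z - h (-z)) * W z) γ :=
    (i1.sub i2).congr (.of_forall fun z => by simp [sub_mul])
  have e3 : ∫ z, (h z - h (-z)) * W z ∂γ = ∫ z, h z * W z ∂γ - ∫ z, h (-z) * W z ∂γ := by
    rw [← integral_sub i1 i2]
    exact integral_congr_ae (.of_forall fun z => by ring)
  have m3 : Measurable fun z => (h z - h (-z)) * W z := by fun_prop
  have e4 := hsymm _ m3
  have i4 : Integrable (fun z => (h (-z) - h (- -z)) * W (-z)) γ := by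
    have e := gaussianReal_map_neg (μ := 0) (v := 1)
    rw [neg_zero] at e
    have hmp : MeasurePreserving (fun z : ℝ => -z) γ γ := ⟨by fun_prop, e⟩
    exact hmp.integrable_comp_of_integrable i3
  -- Twice the difference of the two sides, symmetrized under z ↦ -z, is the mean of (h z - h (-z))
  -- (W z - W (-z)). This is nonnegative because `h = log W` is an increasing function of `W`.
  have hnn : 0 ≤ ∫ z, ((h z - h (-z)) * W z + (h (-z) - h (- -z)) * W (-z)) ∂γ := by
    refine integral_nonneg fun z => ?_
    simp only [neg_neg]
    have : 0 ≤ (h z - h (-z)) * (W z - W (-z)) := by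
      rcases le_total (W z) (W (-z)) with hle | hle
      · exact mul_nonneg_of_nonpos_of_nonpos
          (sub_nonpos.2 (Real.log_le_log (hWpos _) hle)) (sub_nonpos.2 hle)
      · exact mul_nonneg (sub_nonneg.2 (Real.log_le_log (hWpos _) hle)) (sub_nonneg.2 hle)
    simp only [Pi.zero_apply]
    linarith
  rw [integral_add i3 i4, e4, e3] at hnn
  change ∫ xs, ∫ z, h (z - U xs) ∂γ ∂P ≤ ∫ xs, ∫ z, h (z + U xs) ∂γ ∂P
  rw [eplus, eminus]
  linarith

variable {lam : ℝ} {f : ℝ → ℝ} {B : ℝ}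

lemma integral_channelLog_neg_le (hlam : 0 ≤ lam) (hf : Measurable f) (hB : ∀ x, |f x| ≤ B)
    {q : ℝ} (hq : 0 ≤ q) :
    ∫ ω, channelLog P lam f (-q) ω ∂(P.prod (gaussianReal 0 1)) ≤
      ∫ ω, channelLog P lam f q ω ∂(P.prod (gaussianReal 0 1)) := by
  rw [integral_prod _ (integrable_channelLog hlam hf hB),
    integral_prod _ (integrable_channelLog hlam hf hB)]
  have h := integral_log_reflect_le (P := P) (U := fun x => √lam * (√q * f x))
    (c := √lam * (√q * B)) (by fun_prop) fun x => by
      rw [abs_mul, abs_mul, abs_of_nonneg (Real.sqrt_nonneg _), abs_of_nonneg (Real.sqrt_nonneg _)]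
      gcongr
      exact hB x
  have hl : √lam ^ 2 = lam := Real.sq_sqrt hlam
  have hs : √q ^ 2 = q := Real.sq_sqrt hq
  have e1 : ∀ xs z x, √lam * (√q * f x) * (z - √lam * (√q * f xs)) - (√lam * (√q * f x)) ^ 2 / 2 =
      channelExponent lam f (-q) (xs, z) x := fun xs z x => by
    simp only [channelExponent, abs_neg, abs_of_nonneg hq]
    linear_combination (-(√q ^ 2 * f x * f xs) - √q ^ 2 * f x ^ 2 / 2) * hl +
      (-(lam * f x * f xs) - lam * f x ^ 2 / 2) * hs
  have e2 : ∀ xs z x, √lam * (√q * f x) * (z + √lam * (√q * f xs)) - (√lam * (√q * f x)) ^ 2 / 2 =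
      channelExponent lam f q (xs, z) x := fun xs z x => by
    simp only [channelExponent, abs_of_nonneg hq]
    linear_combination (√q ^ 2 * f x * f xs - √q ^ 2 * f x ^ 2 / 2) * hl +
      (lam * f x * f xs - lam * f x ^ 2 / 2) * hs
  simp only [e1, e2] at h
  exact h

lemma integral_channelLog_le_psi (hlam : 0 ≤ lam) (hf : Measurable f) (hB : ∀ x, |f x| ≤ B)
    (hfP : ∀ᵐ x ∂P, f x = x) (m : ℝ) :
    ∫ ω, channelLog P lam f m ω ∂(P.prod (gaussianReal 0 1)) ≤ psi P (lam * |m|) := by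
  rw [psi_eq hlam hfP (abs_nonneg m)]
  rcases abs_cases m with ⟨h, _⟩ | ⟨h, hm⟩
  · rw [h]
  · have := integral_channelLog_neg_le (P := P) hlam hf hB (q := -m) (by linarith)
    rwa [neg_neg, ← h] at this

end Sign

/-! ### Exponential moments and mixtures -/

section Mixture

lemma exp_le_one_add_sq_mul (y : ℝ) : Real.exp y ≤ 1 + y + y ^ 2 * Real.exp |y| := by
  have h0 : 0 ≤ y ^ 2 * (Real.exp |y| - 1) :=
    mul_nonneg (sq_nonneg _) (by linarith [Real.one_le_exp (abs_nonneg y)])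
  rcases le_or_gt |y| 1 with h | h
  · have := (abs_le.1 (Real.abs_exp_sub_one_sub_id_le h)).2
    linarith
  · rcases lt_abs.1 h with h1 | h1
    · rw [abs_of_pos (by linarith)] at h0 ⊢
      have : 0 ≤ (y ^ 2 - 1) * Real.exp y := mul_nonneg (by nlinarith) (Real.exp_pos _).le
      linarith
    · have : Real.exp y ≤ 1 := Real.exp_le_one_iff.2 (by linarith)
      nlinarith

variable {P : Measure ℝ} [IsProbabilityMeasure P]

/-- A second-order expansion of the exponential gives E exp(sX) ≤ 1 + s E X + C₂ s², and 1 + y ≤ exp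
y finishes. The constant depends on the envelope A (1 + |z|) but not on X, so it serves all
strengths in the grid at once. -/
lemma exists_moment_bound (A : ℝ) : ∃ C₂ : ℝ, 0 ≤ C₂ ∧ ∀ X : ℝ × ℝ → ℝ, Measurable X →
    (∀ ω, |X ω| ≤ A * (1 + |ω.2|)) → ∀ s : ℝ, 0 < s → s ≤ 1 →
    Integrable (fun ω => Real.exp (s * X ω)) (P.prod (gaussianReal 0 1)) ∧
    ∫ ω, Real.exp (s * X ω) ∂(P.prod (gaussianReal 0 1)) ≤
      Real.exp (s * ∫ ω, X ω ∂(P.prod (gaussianReal 0 1)) + C₂ * s ^ 2) := by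
  set Q := P.prod (gaussianReal 0 1) with hQ
  have hE : Integrable (fun ω : ℝ × ℝ => Real.exp (2 * A * (1 + |ω.2|))) Q :=
    (integrable_exp_one_add_abs (2 * A)).comp_snd P
  refine ⟨2 * ∫ ω : ℝ × ℝ, Real.exp (2 * A * (1 + |ω.2|)) ∂Q,
    mul_nonneg two_pos.le (integral_nonneg fun _ => (Real.exp_pos _).le), fun X hX hXb s hs hs1 => ?_⟩
  have hXi : Integrable X Q := (integrable_one_add_abs_snd A).mono' hX.aestronglyMeasurable
    (.of_forall hXb)
  have hpt : ∀ ω, Real.exp (s * X ω) ≤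
      1 + s * X ω + s ^ 2 * (2 * Real.exp (2 * A * (1 + |ω.2|))) := fun ω => by
    refine (exp_le_one_add_sq_mul _).trans ?_
    have h1 : (s * X ω) ^ 2 * Real.exp |s * X ω| ≤ s ^ 2 * (X ω ^ 2 * Real.exp |X ω|) := by
      rw [mul_pow, mul_assoc]
      have : |s * X ω| ≤ |X ω| := by
        rw [abs_mul, abs_of_pos hs]
        exact mul_le_of_le_one_left (abs_nonneg _) hs1
      gcongr
    have h2 : X ω ^ 2 ≤ 2 * Real.exp |X ω| := by
      have := Real.quadratic_le_exp_of_nonneg (abs_nonneg (X ω))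
      rw [sq_abs] at this
      linarith [abs_nonneg (X ω)]
    have h3 : X ω ^ 2 * Real.exp |X ω| ≤ 2 * Real.exp (2 * A * (1 + |ω.2|)) :=
      calc _ ≤ 2 * Real.exp |X ω| * Real.exp |X ω| := by gcongr
        _ = 2 * Real.exp (|X ω| + |X ω|) := by rw [Real.exp_add]; ring
        _ ≤ _ := by
          gcongr
          linarith [hXb ω]
    have h4 := mul_le_mul_of_nonneg_left h3 (sq_nonneg s)
    linarith
  have hi1 : Integrable (fun ω => 1 + s * X ω) Q := (integrable_const _).add (hXi.const_mul _)
  have hi2 : Integrable (fun ω : ℝ × ℝ => s ^ 2 * (2 * Real.exp (2 * A * (1 + |ω.2|)))) Q :=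
    (hE.const_mul _).const_mul _
  have hi12 : Integrable (fun ω =>
      1 + s * X ω + s ^ 2 * (2 * Real.exp (2 * A * (1 + |ω.2|)))) Q := hi1.add hi2
  have hXe : Integrable (fun ω => Real.exp (s * X ω)) Q :=
    hi12.mono' (by fun_prop) (.of_forall fun ω => by
      rw [Real.norm_eq_abs, Real.abs_exp]; exact hpt ω)
  refine ⟨hXe, (integral_mono hXe hi12 hpt).trans ?_⟩
  have : ∫ ω, (1 + s * X ω + s ^ 2 * (2 * Real.exp (2 * A * (1 + |ω.2|)))) ∂Q =
      1 + s * ∫ ω, X ω ∂Q + s ^ 2 * (2 * ∫ ω : ℝ × ℝ, Real.exp (2 * A * (1 + |ω.2|)) ∂Q) := by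
    rw [integral_add hi1 hi2, integral_add (integrable_const _) (hXi.const_mul _),
      integral_const_mul, integral_const_mul, integral_const_mul]
    simp
  rw [this]
  refine le_trans (le_of_eq ?_) (Real.add_one_le_exp _)
  ring

lemma measurePreserving_pairs (N : ℕ) (ι : Type*) [Fintype ι] :
    MeasurePreserving (fun (p : (Fin N → ℝ) × (ι ⊕ Fin N → ℝ)) (i : Fin N) =>
        (p.1 i, p.2 (Sum.inr i)))
      ((Measure.pi fun _ => P).prod (gaussPi _))
      (Measure.pi fun _ : Fin N => P.prod (gaussianReal 0 1)) := by
  have h1 : MeasurePreserving (fun g : ι ⊕ Fin N → ℝ => fun i => g (Sum.inr i))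
      (gaussPi (ι ⊕ Fin N)) (gaussPi (Fin N)) :=
    measurePreserving_snd.comp
      (measurePreserving_sumPiEquivProdPi fun _ : ι ⊕ Fin N => gaussianReal 0 1)
  have h2 := (measurePreserving_arrowProdEquivProdArrow ℝ ℝ (Fin N) (fun _ => P)
    (fun _ => gaussianReal 0 1)).symm
  exact h2.comp ((MeasurePreserving.id _).prod h1)

/-- A bound for the mean log-partition function of a mixture of independent scalar channels. -/
lemma interpFree_zero_le {N : ℕ} {lam : ℝ} {f : ℝ → ℝ} {B C : ℝ}
    {m pen : (Fin N → ℝ) → (Fin N → ℝ) → ℝ} (h : ChannelBound m pen C) (hlam : 0 ≤ lam)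
    (hf : Measurable f) (hB : ∀ x, |f x| ≤ B)
    (hpen : ∀ xs x, pen xs x = lam * N / 4 * m xs x ^ 2) {I : Finset ℝ} (hI : I.Nonempty)
    (hmI : ∀ xs x, m xs x ∈ I) {φ C₂ s : ℝ} (hs : 0 < s)
    (hφ : ∀ k ∈ I, ∫ ω, channelLog P lam f k ω ∂(P.prod (gaussianReal 0 1)) - lam * k ^ 2 / 4 ≤ φ)
    (hmom : ∀ k ∈ I, Integrable (fun ω => Real.exp (s * channelLog P lam f k ω))
        (P.prod (gaussianReal 0 1)) ∧
      ∫ ω, Real.exp (s * channelLog P lam f k ω) ∂(P.prod (gaussianReal 0 1)) ≤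
        Real.exp (s * ∫ ω, channelLog P lam f k ω ∂(P.prod (gaussianReal 0 1)) + C₂ * s ^ 2)) :
    interpFree P lam f m pen 0 ≤
      Real.log I.card + 1 / s * Real.log I.card + N * φ + N * C₂ * s := by
  have hL : (0 : ℝ) < I.card := by exact_mod_cast hI.card_pos
  set Q := P.prod (gaussianReal 0 1) with hQ
  set M := (Measure.pi fun _ : Fin N => P).prod (gaussPi (UpperIndex N ⊕ Fin N)) with hM
  set pr : (Fin N → ℝ) × (UpperIndex N ⊕ Fin N → ℝ) → Fin N → ℝ × ℝ :=
    fun p i => (p.1 i, p.2 (Sum.inr i)) with hpr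
  have hmp : MeasurePreserving pr M (Measure.pi fun _ => Q) := measurePreserving_pairs N _
  -- `cc k` is the log-partition function of `N` channels of fixed strength k, minus the penalty.
  set cc : ℝ → (Fin N → ℝ × ℝ) → ℝ := fun k w =>
    ∑ i, channelLog P lam f k (w i) - lam * N / 4 * k ^ 2 with hcc
  set Y : (Fin N → ℝ × ℝ) → ℝ := fun w => ∑ k ∈ I, Real.exp (s * cc k w) with hY
  have hYpos : ∀ w, 0 < Y w := fun w => Finset.sum_pos (fun k _ => Real.exp_pos _) hI
  have hexp : ∀ k w, Real.exp (s * cc k w) = Real.exp (-(s * (lam * N / 4 * k ^ 2))) *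
      ∏ i, Real.exp (s * channelLog P lam f k (w i)) := fun k w => by
    rw [← Real.exp_sum, ← Real.exp_add, ← Finset.mul_sum]
    congr 1
    simp only [hcc]
    ring
  have hYki : ∀ k ∈ I, Integrable (fun w => Real.exp (s * cc k w)) (Measure.pi fun _ => Q) :=
    fun k hk => by
      simp only [hexp]
      exact (Integrable.fintype_prod fun i => (hmom k hk).1).const_mul _
  have hYi : Integrable Y (Measure.pi fun _ => Q) := integrable_finsetSum _ hYki
  set a := ∫ w, Y w ∂(Measure.pi fun _ => Q) with ha
  have hEk : ∀ k ∈ I, ∫ w, Real.exp (s * cc k w) ∂(Measure.pi fun _ => Q) ≤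
      Real.exp (s * N * φ + N * C₂ * s ^ 2) := fun k hk => by
    simp only [hexp]
    rw [integral_const_mul, integral_fintype_prod_eq_pow
      (fun ω => Real.exp (s * channelLog P lam f k ω)), Fintype.card_fin]
    calc _ ≤ Real.exp (-(s * (lam * N / 4 * k ^ 2))) *
          Real.exp (s * ∫ ω, channelLog P lam f k ω ∂Q + C₂ * s ^ 2) ^ N := by
          refine mul_le_mul_of_nonneg_left (pow_le_pow_left₀ ?_ (hmom k hk).2 N) (Real.exp_pos _).le
          exact (integral_exp_pos (hmom k hk).1).le
      _ = Real.exp (s * N * (∫ ω, channelLog P lam f k ω ∂Q - lam * k ^ 2 / 4) +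
          N * C₂ * s ^ 2) := by
          rw [← Real.exp_nat_mul, ← Real.exp_add]
          congr 1
          ring
      _ ≤ _ := by
          gcongr
          exact hφ k hk
  have hale : a ≤ I.card * Real.exp (s * N * φ + N * C₂ * s ^ 2) := by
    rw [ha, integral_finsetSum _ hYki]
    exact (Finset.sum_le_card_nsmul _ _ _ hEk).trans_eq (nsmul_eq_mul _ _)
  have hapos : 0 < a := by
    have : 0 < ∑ k ∈ I, ∫ w, Real.exp (s * cc k w) ∂(Measure.pi fun _ => Q) :=
      Finset.sum_pos (fun k hk => integral_exp_pos (hYki k hk)) hI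
    rwa [ha, integral_finsetSum _ hYki]
  have hloga : Real.log a ≤ Real.log I.card + (s * N * φ + N * C₂ * s ^ 2) := by
    rw [Real.log_le_iff_le_exp hapos, Real.exp_add, Real.exp_log hL]
    exact hale
  -- Pointwise log-sum-exp bounds: Z ≤ ∑ exp (cc k) ≤ |I| exp (max cc k), and s · max cc k ≤ log Y.
  -- The tangent line of log at a = E Y then plays the role of Jensen's inequality.
  have hpt : ∀ p, Real.log (∫ x, Real.exp (interpEnergy lam f m pen 0 p.1 p.2 x)
      ∂(Measure.pi fun _ => P)) ≤
      Real.log I.card + 1 / s * (Real.log a + (1 / a * Y (pr p) - 1)) := fun p => by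
    obtain ⟨K, hK⟩ := h.exists_fieldBound hlam hf hB
    have hEm := hK.measurable_energy_right (amplitude 0) (Real.sin 0 ^ 2) p.1 p.2
    have hEb := hK.abs_energy_le (abs_amplitude_le 0) (abs_sin_sq_le 0) p.1 p.2
    have hIpos : 0 < ∫ x, Real.exp (interpEnergy lam f m pen 0 p.1 p.2 x)
        ∂(Measure.pi fun _ => P) :=
      integral_exp_pos_of_abs_le (μ := Measure.pi fun _ : Fin N => P) hEm hEb
    have hIi := integrable_exp_of_abs_le (ν := Measure.pi fun _ : Fin N => P) hEm hEb
    have hcm : ∀ k w, Measurable (channelExponent lam f k w) := fun k w =>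
      (measurable_channelExponent hf).comp measurable_prodMk_left
    have hce : ∀ k w, 0 < ∫ x, Real.exp (channelExponent lam f k w x) ∂P := fun k w =>
      integral_exp_pos_of_abs_le (hcm k w) (abs_channelExponent_le hlam hB le_rfl w)
    have hci : ∀ k, Integrable (fun x : Fin N → ℝ =>
        Real.exp (-(lam * N / 4 * k ^ 2)) * ∏ i, Real.exp (channelExponent lam f k (pr p i) (x i)))
        (Measure.pi fun _ => P) := fun k =>
      (Integrable.fintype_prod fun i => integrable_exp_of_abs_le (hcm k _)
        (abs_channelExponent_le hlam hB le_rfl _)).const_mul _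
    have h1 : ∫ x, Real.exp (interpEnergy lam f m pen 0 p.1 p.2 x) ∂(Measure.pi fun _ => P) ≤
        ∑ k ∈ I, Real.exp (cc k (pr p)) := by
      have e : ∀ k, Real.exp (cc k (pr p)) = ∫ x : Fin N → ℝ, Real.exp (-(lam * N / 4 * k ^ 2)) *
          ∏ i, Real.exp (channelExponent lam f k (pr p i) (x i)) ∂(Measure.pi fun _ => P) :=
        fun k => by
          rw [integral_const_mul, integral_fintype_prod_eq_prod (fun i y =>
            Real.exp (channelExponent lam f k (pr p i) y))]
          simp only [hcc]
          rw [sub_eq_neg_add, Real.exp_add, Real.exp_sum]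
          congr 1
          exact Finset.prod_congr rfl fun i _ => Real.exp_log (hce k _)
      simp only [e]
      rw [← integral_finsetSum _ fun k _ => hci k]
      refine integral_mono hIi (integrable_finsetSum _ fun k _ => hci k) fun x => ?_
      -- Each configuration's weight is exactly the summand with k = m(xs, x). Summing over all k
      -- removes the dependence of the strength on `x`.
      refine le_trans (le_of_eq ?_) (Finset.single_le_sum (f := fun k =>
        Real.exp (-(lam * N / 4 * k ^ 2)) * ∏ i, Real.exp (channelExponent lam f k (pr p i) (x i)))
        (fun k _ => by positivity) (hmI p.1 x))
      simp only
      rw [← Real.exp_sum, ← Real.exp_add, interpEnergy_zero, scalarDrift, innerSum, hpen]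
      congr 1
      simp only [hpr, channelExponent, Finset.sum_add_distrib, Finset.sum_sub_distrib,
        Finset.mul_sum]
      ring
    have h2 : ∑ k ∈ I, Real.exp (cc k (pr p)) ≤
        I.card * Real.exp (1 / s * Real.log (Y (pr p))) := by
      refine (Finset.sum_le_card_nsmul _ _ _ fun k hk => ?_).trans_eq (nsmul_eq_mul _ _)
      refine Real.exp_le_exp.2 ?_
      have : s * cc k (pr p) ≤ Real.log (Y (pr p)) :=
        (Real.le_log_iff_exp_le (hYpos _)).2
          (Finset.single_le_sum (f := fun k => Real.exp (s * cc k (pr p)))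
            (fun k _ => (Real.exp_pos _).le) hk)
      rw [div_mul_eq_mul_div, one_mul, le_div_iff₀ hs]
      linarith
    have h3 : Real.log (Y (pr p)) ≤ Real.log a + (1 / a * Y (pr p) - 1) := by
      have := Real.log_le_sub_one_of_pos (div_pos (hYpos (pr p)) hapos)
      rw [Real.log_div (hYpos _).ne' hapos.ne'] at this
      have e : Y (pr p) / a = 1 / a * Y (pr p) := by ring
      linarith
    have h4 : Real.log (∫ x, Real.exp (interpEnergy lam f m pen 0 p.1 p.2 x)
        ∂(Measure.pi fun _ => P)) ≤ Real.log I.card + 1 / s * Real.log (Y (pr p)) := by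
      rw [Real.log_le_iff_le_exp hIpos, Real.exp_add, Real.exp_log hL]
      exact h1.trans h2
    have h5 := mul_le_mul_of_nonneg_left h3 (show 0 ≤ 1 / s by positivity)
    linarith
  have hYp : Integrable (fun p => Y (pr p)) M := hmp.integrable_comp_of_integrable hYi
  have hYint : ∫ p, Y (pr p) ∂M = a := by
    rw [ha, ← hmp.map_eq, integral_map hmp.measurable.aemeasurable
      (by rw [hmp.map_eq]; exact hYi.aestronglyMeasurable)]
  have hi2 : Integrable (fun p => Real.log a + (1 / a * Y (pr p) - 1)) M :=
    (integrable_const _).add ((hYp.const_mul _).sub (integrable_const _))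
  have hi4 : Integrable (fun p => Real.log I.card + 1 / s *
      (Real.log a + (1 / a * Y (pr p) - 1))) M := (integrable_const _).add (hi2.const_mul (1 / s))
  have hfin := integral_mono (integrable_interp (P := P) h hlam hf hB 0) hi4 hpt
  have hval : ∫ p, (Real.log I.card + 1 / s * (Real.log a + (1 / a * Y (pr p) - 1))) ∂M = Real.log I.card + 1 / s * Real.log a := by
    have hi3 : Integrable (fun p => 1 / a * Y (pr p) - 1) M :=
      (hYp.const_mul _).sub (integrable_const _)
    rw [integral_add (integrable_const _) (hi2.const_mul _), integral_const_mul,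
      integral_add (integrable_const _) hi3, integral_sub (hYp.const_mul _) (integrable_const _),
      integral_const_mul, hYint]
    simp [hapos.ne']
  have hlast := mul_le_mul_of_nonneg_left hloga (show 0 ≤ 1 / s by positivity)
  have e : 1 / s * (Real.log I.card + (s * N * φ + N * C₂ * s ^ 2)) =
      1 / s * Real.log I.card + N * φ + N * C₂ * s := by
    field_simp
    ring
  unfold interpFree
  rw [hval] at hfin
  linarith

end Mixture

/-! ### The replica-symmetric formula -/

section Main

variable {P : Measure ℝ} [IsProbabilityMeasure P] {lam : ℝ} {f : ℝ → ℝ} {B : ℝ}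

lemma bddAbove_rsPotential (hlam : 0 ≤ lam) (hf : Measurable f) (hB : ∀ x, |f x| ≤ B)
    (hfP : ∀ᵐ x ∂P, f x = x) : BddAbove (rsPotential P lam '' Set.Ici 0) := by
  have hB0 := (abs_nonneg _).trans (hB 0)
  set G := ∫ ω : ℝ × ℝ, (1 + |ω.2|) ∂(P.prod (gaussianReal 0 1)) with hG
  have hG0 : 0 ≤ G := integral_nonneg fun ω => add_nonneg zero_le_one (abs_nonneg _)
  -- The square-root term of ψ is at most lam q + (B G)²/4, and the resulting lam q (1 + 3/2 B² G) -
  -- lam q²/4 is maximized by completing the square.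
  refine ⟨(B * G) ^ 2 / 4 + lam * (1 + 3 / 2 * B ^ 2 * G) ^ 2, ?_⟩
  rintro _ ⟨q, hq, rfl⟩
  have hq0 : 0 ≤ q := hq
  have h1 : psi P (lam * q) ≤
      (√lam * (√q * B) + lam * (q * (B * B)) + lam / 2 * (q * B ^ 2)) * G := by
    rw [psi_eq hlam hfP hq0, hG, ← integral_const_mul]
    exact integral_mono (integrable_channelLog hlam hf hB) (integrable_one_add_abs_snd _)
      fun ω => (le_abs_self _).trans (abs_channelLog_le hlam hf hB (abs_of_nonneg hq0).le ω)
  have hl : √lam ^ 2 = lam := Real.sq_sqrt hlam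
  have hs : √q ^ 2 = q := Real.sq_sqrt hq0
  have h2 : √lam * √q * (B * G) ≤ lam * q + (B * G) ^ 2 / 4 := by
    have e : (√lam * √q) ^ 2 = lam * q := by rw [mul_pow, hl, hs]
    nlinarith [sq_nonneg (√lam * √q - B * G / 2)]
  have h3 : 0 ≤ lam * (q / 2 - (1 + 3 / 2 * B ^ 2 * G)) ^ 2 := by positivity
  unfold rsPotential
  nlinarith

lemma rsPotential_sub_le_freeEntropy (hlam : 0 ≤ lam) (hf : Measurable f) (hB : ∀ x, |f x| ≤ B)
    (hfP : ∀ᵐ x ∂P, f x = x) (σ : ℝ≥0) {N : ℕ} (hN : 0 < N) {q : ℝ} (hq : 0 ≤ q) :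
    rsPotential P lam q - lam * B ^ 4 / 4 / N ≤ freeEntropy P σ lam N := by
  have hN' : (0 : ℝ) < N := by exact_mod_cast hN
  rw [freeEntropy, (integrable_and_integral_logPartition (channelBound_const q) hlam hf hB hfP σ).2]
  have h := le_interpFree (P := P) hlam hf hB hN hq
  rw [integral_interp_zero hlam hf hB, ← psi_eq hlam hfP hq] at h
  rw [one_div_mul_eq_div, le_div_iff₀ hN', rsPotential]
  refine le_trans (le_of_eq ?_) h
  field_simp
  ring

lemma card_image_Icc_le {N M : ℕ} (hN : 0 < N) (hM : 0 < M) :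
    (((Finset.Icc (-(N * M : ℤ)) (N * M)).image fun k : ℤ => (k : ℝ) / N).card : ℝ) ≤
      3 * M * N := by
  have h1 : ((Finset.Icc (-(N * M : ℤ)) (N * M)).image fun k : ℤ => (k : ℝ) / N).card ≤
      2 * (N * M) + 1 := by
    refine Finset.card_image_le.trans ?_
    rw [Int.card_Icc]
    omega
  have h2 : 1 ≤ N * M := Nat.mul_pos hN hM
  have h3 : 2 * (N * M) + 1 ≤ 3 * M * N := by nlinarith
  exact_mod_cast h1.trans h3

lemma exists_freeEntropy_le (hlam : 0 ≤ lam) (hf : Measurable f) (hB : ∀ x, |f x| ≤ B)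
    (hfP : ∀ᵐ x ∂P, f x = x) : ∃ K : ℝ, 0 ≤ K ∧ ∀ (σ : ℝ≥0) (N : ℕ), 2 ≤ N →
      freeEntropy P σ lam N ≤ phiRS P lam + K * (Real.log N / √(N : ℝ)) := by
  have hbdd := bddAbove_rsPotential (P := P) hlam hf hB hfP
  have hB0 := (abs_nonneg _).trans (hB 0)
  obtain ⟨M, hM0, hBM⟩ : ∃ M : ℕ, 0 < M ∧ B ^ 2 ≤ M :=
    ⟨⌈B ^ 2⌉₊ + 1, Nat.succ_pos _, (Nat.le_ceil _).trans (by push_cast; linarith)⟩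
  have hM1 : (1 : ℝ) ≤ M := by exact_mod_cast hM0
  obtain ⟨C₂, hC₂0, hC₂⟩ := exists_moment_bound (P := P)
    (√lam * (√M * B) + lam * (M * (B * B)) + lam / 2 * (M * B ^ 2))
  have hlog2 : 0 < Real.log 2 := Real.log_pos one_lt_two
  have hlogM : 0 ≤ Real.log (3 * M) := Real.log_nonneg (by linarith)
  -- The grid has at most 3MN points, and `c₁` is chosen so that log(3MN) ≤ c₁ log N for N ≥ 2.
  -- Dividing by log 2 likewise absorbs constants into log N.
  set c₁ := Real.log (3 * M) / Real.log 2 + 1 with hc₁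
  set c₂ := C₂ + (lam * B ^ 4 / 4 + lam / 2) with hc₂
  have hc₂0 : 0 ≤ c₂ := by positivity
  refine ⟨2 * c₁ + c₂ / Real.log 2, by positivity, fun σ N hN => ?_⟩
  have hN0 : 0 < N := by omega
  have hN' : (0 : ℝ) < N := by exact_mod_cast hN0
  have hN1 : (1 : ℝ) ≤ N := by exact_mod_cast hN0
  have hN2 : (2 : ℝ) ≤ N := by exact_mod_cast hN
  -- The overlap rounded down to a multiple of 1/N, so that `innerSum` and `N * m` differ by less
  -- than 1 while `m` takes O(N) values.
  set m : (Fin N → ℝ) → (Fin N → ℝ) → ℝ := fun xs x => (⌊innerSum f xs x⌋ : ℝ) / N with hm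
  set pen : (Fin N → ℝ) → (Fin N → ℝ) → ℝ := fun xs x => lam * N / 4 * m xs x ^ 2 with hpen
  set I : Finset ℝ := (Finset.Icc (-(N * M : ℤ)) (N * M)).image fun k : ℤ => (k : ℝ) / N with hI
  have hmI : ∀ xs x, m xs x ∈ I := fun xs x => by
    have h1 := abs_le.1 ((abs_innerSum_le hB xs x).trans
      (mul_le_mul_of_nonneg_left hBM hN'.le))
    refine Finset.mem_image_of_mem _ (Finset.mem_Icc.2 ⟨Int.le_floor.2 (by push_cast; exact h1.1), ?_⟩)
    have := (Int.floor_le (innerSum f xs x)).trans h1.2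
    exact_mod_cast this
  have hIM : ∀ k ∈ I, |k| ≤ M := fun k hk => by
    obtain ⟨j, hj, rfl⟩ := Finset.mem_image.1 hk
    rw [Finset.mem_Icc] at hj
    rw [abs_div, abs_of_pos hN', div_le_iff₀ hN', abs_le]
    constructor
    · have : ((-(N * M : ℤ) : ℤ) : ℝ) ≤ j := by exact_mod_cast hj.1
      push_cast at this
      linarith
    · have : (j : ℝ) ≤ ((N * M : ℤ) : ℝ) := by exact_mod_cast hj.2
      push_cast at this
      linarith
  have hmm : Measurable fun p : (Fin N → ℝ) × (Fin N → ℝ) => m p.1 p.2 := by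
    have h1 : Measurable fun p : (Fin N → ℝ) × (Fin N → ℝ) => ⌊innerSum f p.1 p.2⌋ :=
      (measurable_innerSum hf).floor
    exact (measurable_from_top (f := fun k : ℤ => (k : ℝ)).comp h1).div_const _
  have hmM : ∀ xs x, |m xs x| ≤ M := fun xs x => hIM _ (hmI xs x)
  have hch : ChannelBound m pen (M + lam * N / 4 * M ^ 2) := by
    refine ⟨hmm, (hmm.pow_const 2).const_mul _, fun xs x => ?_, fun xs x => ?_⟩
    · exact (hmM xs x).trans (le_add_of_nonneg_right (by positivity))
    · simp only [hpen]
      rw [abs_mul, abs_pow, abs_of_nonneg (show 0 ≤ lam * N / 4 by positivity)]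
      have := mul_le_mul_of_nonneg_left (pow_le_pow_left₀ (abs_nonneg _) (hmM xs x) 2)
        (show 0 ≤ lam * N / 4 by positivity)
      linarith
  have hround : ∀ xs x, |innerSum f xs x - N * m xs x| ≤ 1 := fun xs x => by
    simp only [hm]
    rw [mul_div_cancel₀ _ hN'.ne', abs_le]
    constructor
    · linarith [Int.floor_le (innerSum f xs x)]
    · linarith [Int.lt_floor_add_one (innerSum f xs x)]
  have hs0 : 0 < √(N : ℝ) := Real.sqrt_pos.2 hN'
  have hs1 : 1 ≤ √(N : ℝ) := Real.one_le_sqrt.2 hN1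
  have hss : √(N : ℝ) * √N = N := Real.mul_self_sqrt hN'.le
  have hIne : I.Nonempty := ⟨_, hmI 0 0⟩
  -- The choice s = 1/√N makes log|I|/s of order √N log N and N C₂ s of order √N.
  have hmain := interpFree_zero_le (P := P) hch hlam hf hB (fun _ _ => rfl) hIne hmI
    (φ := phiRS P lam) (C₂ := C₂) (s := 1 / √N) (by positivity)
    (fun k _ => by
      have h1 : rsPotential P lam |k| ≤ phiRS P lam :=
        -- The penalty is even in k, so it matches the subtracted term of the potential at q = |k|.
        le_csSup hbdd ⟨|k|, abs_nonneg k, rfl⟩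
      rw [rsPotential, sq_abs] at h1
      linarith [integral_channelLog_le_psi (P := P) hlam hf hB hfP k])
    fun k hk => hC₂ _ (measurable_channelLog hf) (abs_channelLog_le hlam hf hB (hIM k hk)) _
      (by positivity) (by rw [div_le_one hs0]; exact hs1)
  have hint := interpFree_le (P := P) hch hlam hf hB hN0 hround fun _ _ => rfl
  rw [freeEntropy, (integrable_and_integral_logPartition hch hlam hf hB hfP σ).2,
    one_div_mul_eq_div, div_le_iff₀ hN']
  have hlogN : Real.log 2 ≤ Real.log N := Real.log_le_log two_pos hN2
  have hlogI : Real.log I.card ≤ c₁ * Real.log N := by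
    have h1 : Real.log I.card ≤ Real.log (3 * M) + Real.log N := by
      rw [← Real.log_mul (by positivity) hN'.ne']
      exact Real.log_le_log (by exact_mod_cast hIne.card_pos) (card_image_Icc_le hN0 hM0)
    have h2 : Real.log (3 * M) ≤ Real.log (3 * M) / Real.log 2 * Real.log N := by
      rw [div_mul_eq_mul_div, le_div_iff₀ hlog2]
      gcongr
    simp only [hc₁]
    linarith
  have hlogI0 : 0 ≤ Real.log I.card := Real.log_natCast_nonneg _
  have e1 : 1 / (1 / √(N : ℝ)) = √N := by rw [one_div_one_div]
  have e2 : N * C₂ * (1 / √(N : ℝ)) = C₂ * √N := by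
    rw [mul_one_div, div_eq_iff hs0.ne']
    linear_combination -C₂ * hss
  have e3 : (phiRS P lam + (2 * c₁ + c₂ / Real.log 2) * (Real.log N / √(N : ℝ))) * N =
      N * phiRS P lam + (2 * c₁ * Real.log N + c₂ / Real.log 2 * Real.log N) * √N := by
    have : Real.log N / √(N : ℝ) * N = Real.log N * √N := by
      rw [div_mul_eq_mul_div, div_eq_iff hs0.ne']
      linear_combination -Real.log N * hss
    linear_combination (2 * c₁ + c₂ / Real.log 2) * this
  rw [e1, e2] at hmain
  rw [e3]
  have h4 : c₂ ≤ c₂ / Real.log 2 * Real.log N := by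
    rw [div_mul_eq_mul_div, le_div_iff₀ hlog2]
    gcongr
  have h5 : Real.log I.card ≤ √N * Real.log I.card := le_mul_of_one_le_left hlogI0 hs1
  have h6 : √N * Real.log I.card ≤ √N * (c₁ * Real.log N) := by gcongr
  have h7 : c₂ * √N ≤ c₂ / Real.log 2 * Real.log N * √N := by gcongr
  have h8 : lam * B ^ 4 / 4 + lam / 2 ≤ (lam * B ^ 4 / 4 + lam / 2) * √N :=
    le_mul_of_one_le_right (by positivity) hs1
  have h9 : c₂ * √N = C₂ * √N + (lam * B ^ 4 / 4 + lam / 2) * √N := by rw [hc₂]; ring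
  linarith

lemma tendsto_log_div_sqrt : Tendsto (fun N : ℕ => Real.log N / √(N : ℝ)) atTop (𝓝 0) := by
  have h := (isLittleO_log_rpow_atTop (show (0 : ℝ) < 1 / 2 by norm_num)).tendsto_div_nhds_zero
  simp only [← Real.sqrt_eq_rpow] at h
  exact h.comp tendsto_natCast_atTop_atTop

-- Truncation to an interval containing the support: it turns the almost sure bound on the entries
-- into one valid everywhere without changing any integral against `P`.
omit [IsProbabilityMeasure P] in
lemma exists_clamp (hP : Bornology.IsBounded P.support) :
    ∃ (B : ℝ) (f : ℝ → ℝ), Measurable f ∧ (∀ x, |f x| ≤ B) ∧ (∀ᵐ x ∂P, f x = x) := by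
  obtain ⟨R, hR⟩ := hP.subset_closedBall 0
  refine ⟨|R|, fun x => max (-|R|) (min |R| x), by fun_prop, fun x => ?_, ?_⟩
  · rw [abs_le]
    exact ⟨le_max_left _ _, max_le (neg_le_self (abs_nonneg R)) (min_le_left _ _)⟩
  · filter_upwards [Measure.support_mem_ae (μ := P)] with x hx
    have h := hR hx
    rw [Metric.mem_closedBall, Real.dist_eq, sub_zero] at h
    have := abs_le.1 (h.trans (le_abs_self R))
    rw [min_eq_right this.2, max_eq_right this.1]

omit [IsProbabilityMeasure P] in
lemma integrable_of_continuous_of_ae_bounded [IsFiniteMeasure P] (hB : ∀ᵐ x ∂P, |x| ≤ B)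
    {g : ℝ → ℝ} (hg : Continuous g) : Integrable g P := by
  obtain ⟨C, hC⟩ := (isCompact_closedBall (0 : ℝ) B).exists_bound_of_continuousOn hg.continuousOn
  refine .of_bound hg.aestronglyMeasurable C ?_
  filter_upwards [hB] with x hx
  exact hC x (by simpa [Real.dist_eq] using hx)

lemma integrable_pi_of_continuous_of_ae_bounded (hB : ∀ᵐ x ∂P, |x| ≤ B) (hB0 : 0 ≤ B) {N : ℕ}
    {g : (Fin N → ℝ) → ℝ} (hg : Continuous g) : Integrable g (Measure.pi fun _ => P) := by
  obtain ⟨C, hC⟩ := (isCompact_closedBall (0 : Fin N → ℝ) B).exists_bound_of_continuousOn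
    hg.continuousOn
  refine .of_bound hg.aestronglyMeasurable C ?_
  filter_upwards [ae_pi_forall hB] with x hx
  exact hC x (by simpa using (pi_norm_le_iff_of_nonneg hB0).2 hx)

end Main

end

end SpikedWigner

open SpikedWigner in
theorem theorem1 (P : Measure ℝ) [IsProbabilityMeasure P] (hP : Bornology.IsBounded P.support)
    (lam : ℝ) (hlam : 0 ≤ lam) :
    -- all the integrals, expectations and the supremum are finite
    ((∀ (N : ℕ) (Y : Matrix (Fin N) (Fin N) ℝ),
        Integrable (fun x => Real.exp (SpikedWigner.negHamiltonian lam Y x))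
          (Measure.pi fun _ : Fin N => P)) ∧
      (∀ (σ : ℝ≥0) (N : ℕ),
        Integrable (SpikedWigner.logPartition P lam) (SpikedWigner.jointLaw P σ N)) ∧
      (∀ r xs z : ℝ, 0 ≤ r → Integrable (SpikedWigner.scalarWeight r xs z) P) ∧
      (∀ r : ℝ, 0 ≤ r →
        Integrable (SpikedWigner.scalarLogPartition P r) (P.prod (gaussianReal 0 1))) ∧
      BddAbove (SpikedWigner.rsPotential P lam '' Set.Ici 0)) ∧
    -- convergence to the replica-symmetric formula
    (∀ σ : ℝ≥0,
      Tendsto (SpikedWigner.freeEntropy P σ lam) atTop (𝓝 (SpikedWigner.phiRS P lam))) ∧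
    -- lower and upper bound with their error terms
    (∃ K : ℝ, ∀ σ : ℝ≥0,
      (∀ N : ℕ, 1 ≤ N →
        SpikedWigner.phiRS P lam - K / N ≤ SpikedWigner.freeEntropy P σ lam N) ∧
      (∀ N : ℕ, 2 ≤ N →
        SpikedWigner.freeEntropy P σ lam N ≤
          SpikedWigner.phiRS P lam + K * (Real.log N / √(N : ℝ)))) := by
  obtain ⟨B, f, hf, hB, hfP⟩ := exists_clamp hP
  have hB0 := (abs_nonneg _).trans (hB 0)
  have hae : ∀ᵐ x ∂P, |x| ≤ B := hfP.mono fun x hx => hx ▸ hB x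
  have hbounds : ∃ K : ℝ, ∀ σ : ℝ≥0,
      (∀ N : ℕ, 1 ≤ N → phiRS P lam - K / N ≤ freeEntropy P σ lam N) ∧
      (∀ N : ℕ, 2 ≤ N →
        freeEntropy P σ lam N ≤ phiRS P lam + K * (Real.log N / √(N : ℝ))) := by
    obtain ⟨K, hK0, hK⟩ := exists_freeEntropy_le (P := P) hlam hf hB hfP
    have hK1 : 0 ≤ lam * B ^ 4 / 4 := by positivity
    refine ⟨lam * B ^ 4 / 4 + K, fun σ => ⟨fun N hN => ?_, fun N hN => ?_⟩⟩
    · have hle : phiRS P lam ≤ freeEntropy P σ lam N + lam * B ^ 4 / 4 / N := by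
        refine csSup_le (Set.nonempty_Ici.image _) ?_
        rintro _ ⟨q, hq, rfl⟩
        linarith [rsPotential_sub_le_freeEntropy (P := P) hlam hf hB hfP σ hN hq]
      rw [add_div]
      have : 0 ≤ K / N := by positivity
      linarith
    · refine (hK σ N hN).trans ?_
      have : 0 ≤ Real.log N / √(N : ℝ) := div_nonneg (Real.log_natCast_nonneg _) (Real.sqrt_nonneg _)
      nlinarith [mul_nonneg hK1 this]
  refine ⟨⟨fun N Y => ?_, fun σ N => ?_, fun r xs z _ => ?_, fun r hr => ?_,
    bddAbove_rsPotential hlam hf hB hfP⟩, fun σ => ?_, hbounds⟩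
  · refine integrable_pi_of_continuous_of_ae_bounded hae hB0 ?_
    unfold negHamiltonian
    fun_prop
  · exact (integrable_and_integral_logPartition (channelBound_const 0) hlam hf hB hfP σ).1
  · refine integrable_of_continuous_of_ae_bounded hae ?_
    unfold scalarWeight
    fun_prop
  -- The scalar channel of signal-to-noise ratio r is the one with `lam := r` and unit strength.
  · have h := scalarLogPartition_ae_eq (P := P) hr hfP zero_le_one
    rw [mul_one] at h
    exact (integrable_channelLog hr hf hB).congr h.symm
  · obtain ⟨K, hK⟩ := hbounds
    have h1 : Tendsto (fun N : ℕ => phiRS P lam - K / N) atTop (𝓝 (phiRS P lam)) := by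
      simpa using (tendsto_const_nhds (x := phiRS P lam)).sub
        (tendsto_const_div_atTop_nhds_zero_nat K)
    have h2 : Tendsto (fun N : ℕ => phiRS P lam + K * (Real.log N / √(N : ℝ))) atTop
        (𝓝 (phiRS P lam)) := by
      simpa using (tendsto_const_nhds (x := phiRS P lam)).add (tendsto_log_div_sqrt.const_mul K)
    refine tendsto_of_tendsto_of_tendsto_of_le_of_le' h1 h2 ?_ ?_
    · filter_upwards [eventually_ge_atTop 1] with N hN using (hK σ).1 N hN
    · filter_upwards [eventually_ge_atTop 2] with N hN using (hK σ).2 N hN
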